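/- **Setting.** Distributions on $\{0,1\}^n$ are compared by the Hellinger distance $d_H(P,Q)=\frac1{\sqrt2}\big(\sum_x(\sqrt{P(x)}-\sqrt{Q(x)})^2\big)^{1/2}$. For a distribution $\mathcal D$ on $\{0,1\}^n$ let $|\psi_{\mathcal D}\rangle=\sum_x\sqrt{\mathcal D(x)}\,|x\rangle$. A circuit $C$ on $n$ qubits is a sequence of $T$ unitary gates, each acting on at most $k$ qubits; $\mathcal D_C(x)=|\langle x|U_C|0^n\rangle|^2$, and $\Phi_C$ is the diagonal unitary $|x\rangle\mapsto e^{i\arg\langle x|U_C|0^n\rangle}|x\rangle$ (with $\arg 0=0$), which is the identity if $U_C|0^n\rangle=|\psi_{\mathcal D_C}\rangle$. The comparison circuit $G$ of $C$ acts on registers out ($1$ qubit), adv ($n$ qubits), aux ($n$ qubits) and consists of $T'=n+T+3$ gates $G_1,\dots,G_{T'}$: the gates of $C$ on aux, a Hadamard on out, the $n$ swaps of the $i$-th qubits of adv and aux controlled by out, a Hadamard on out, a NOT on out. With $|j\rangle_{\rm clock}=|1^j0^{T'-j}\rangle$ on $T'$ further qubits, the history state of an $n$-qubit state $|\psi\rangle$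 is $$|\phi_\psi\rangle=\frac1{\sqrt{T'+1}}\sum_{j=0}^{T'}|j\rangle_{\rm clock}\otimes G_j\cdots G_1|0\rangle_{\rm out}|\psi\rangle_{\rm adv}|0^n\rangle_{\rm aux}.$$ In a receive-and-measure protocol with $N$ rounds the prover sends, in each round, a fresh copy of one and the same (possibly mixed) state $\rho$ on the $n'=2n+1+T'$ qubits (clock, out, adv, aux), one qubit at a time. The verifier tosses classical coins, independently in each round, measures each arriving qubit separately in a Pauli basis ($X$, $Y$ or $Z$) determined by the coins, and keeps only classical information; so it needs quantum memory for one qubit only. After the last round it computes from its classical record either $\bot$ (reject) or a finite sequence $S$ of elements of $\{0,1\}^n$ (accept). "$S\sim_{\rm i.i.d.}\mathcal D^{|S|}$" means: for every $m$, given that the verifier accepts with $|S|=m$, the sequence $S$ has law $\mathcal D^{m}$. For a state $\rho$ let $q(\rho)$ be the probability that measuring all qubits of $\rho$ in the $Z$ basis gives only zeros in clock, out and aux, and, if $q(\rho)>0$, let $\mathcal D^A$ be the law of the content of adv conditioned on this event. **Theorem (Constant Memory Quantum Verifier).** There are absolute constants $\eta_0,c_D,c_S>0$ and, for every $k$, a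 constant $c_N>0$ depending only on $k$, such that the following holds. For every $n\ge1$, every circuit $C$ on $n$ qubits with $T\ge0$ gates, each acting on at most $k$ qubits, every $\delta\in(0,\frac13)$, every integer $K\ge1$ and every $\eta\in(0,\eta_0]$ there is a receive-and-measure protocol as above with $$N\le c_N\,\frac{K\,(n^5+n^2T^3+T^5)}{\eta^4}\,\log(1/\delta)$$ rounds, in which each message has $n'\le 7(n+T)$ qubits, such that: * (Completeness) For every distribution $\mathcal D$ on $\{0,1\}^n$ with $d_H(\mathcal D,\mathcal D_C)\le\eta$: if the prover sends in each round the history state of $\Phi_C|\psi_{\mathcal D}\rangle$, then with probability at least $1-\delta$ the verifier accepts with $|S|\ge c_S K$, and $S\sim_{\rm i.i.d.}\mathcal D^{|S|}$. * (Soundness) For every density matrix $\rho$ on $n'$ qubits: if the verifier accepts with probability at least $\frac23$ when the prover sends $\rho$ in each round, then $q(\rho)>0$, $S\sim_{\rm i.i.d.}(\mathcal D^A)^{|S|}$ and $d_H(\mathcal D_C,\mathcal D^A)\le c_D\,\eta^{1/4}$. -/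

import Mathlib

open scoped BigOperators Matrix ComplexOrder

noncomputable section

namespace QVerifier

/-! Qubits labelled by a finite type `ι`: the computational basis is `ι → Bool`, state vectors are
functions `(ι → Bool) → ℂ`, operators are matrices over `ι → Bool`. -/

/-- A gate on the qubits `ι`: a unitary on `arity` qubits together with the (distinct) wires
to which it is applied. -/
structure Gate (ι : Type) where
  arity : ℕ
  wires : Fin arity ↪ ι
  op : Matrix.unitaryGroup (Fin arity → Bool) ℂ

/-- The same gate applied to relabelled qubits. -/
def Gate.map {ι κ : Type} (f : ι ↪ κ) (g : Gate ι) : Gate κ where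
  arity := g.arity
  wires := g.wires.trans f
  op := g.op

open Classical in
/-- The operator of a gate on all the qubits: `op` on its wires, tensored with the identity. -/
def Gate.toMatrix {ι : Type} (g : Gate ι) : Matrix (ι → Bool) (ι → Bool) ℂ :=
  fun x y =>
    if ∀ i, i ∉ Set.range g.wires → x i = y i then
      (g.op : Matrix (Fin g.arity → Bool) (Fin g.arity → Bool) ℂ)
        (fun a => x (g.wires a)) (fun a => y (g.wires a))
    else 0

/-- Apply a list of operators to a vector, the head of the list first. -/
def applyAll {B : Type} [Fintype B] (l : List (Matrix B B ℂ)) (v : B → ℂ) : B → ℂ :=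
  l.foldl (fun w A => A *ᵥ w) v

/-- The output state `U_C |0…0⟩` of a circuit `C` on `n` qubits (a list of gates, the first gate
at the head). -/
def circuitState {n : ℕ} (C : List (Gate (Fin n))) : (Fin n → Bool) → ℂ :=
  applyAll (C.map Gate.toMatrix) (Pi.single (fun _ => false) 1)

/-- `D_C`: the distribution of the outcome when `U_C |0…0⟩` is measured in the `Z` basis. -/
def circuitDist {n : ℕ} (C : List (Gate (Fin n))) (x : Fin n → Bool) : ℝ :=
  ‖circuitState C x‖ ^ 2

/-- Hellinger distance of two distributions on a finite set. -/
def hellinger {B : Type} [Fintype B] (P Q : B → ℝ) : ℝ :=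
  (1 / √2) * √(∑ x, (√(P x) - √(Q x)) ^ 2)

/-- The quantum sample `|ψ_D⟩ = ∑ₓ √D(x) |x⟩`. -/
def qsample {n : ℕ} (D : (Fin n → Bool) → ℝ) : (Fin n → Bool) → ℂ :=
  fun x => ((√(D x) : ℝ) : ℂ)

/-- The diagonal unitary `|x⟩ ↦ e^{iθ(x)} |x⟩`, with `θ(x)` the argument of the amplitude of `x` in
`U_C |0…0⟩` (`θ(x) = 0` if that amplitude is zero). It depends only on `C`, does not change outcome
probabilities in the `Z` basis, and is the identity when `U_C |0…0⟩ = |ψ_{D_C}⟩`. -/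
def alignPhase {n : ℕ} (C : List (Gate (Fin n))) (ψ : (Fin n → Bool) → ℂ) :
    (Fin n → Bool) → ℂ :=
  fun x => Complex.exp (((circuitState C x).arg : ℂ) * Complex.I) * ψ x

/-! ### The comparison circuit and its history state -/

/-- Qubits of the comparison circuit: `out` (one qubit), `adv` (`n` qubits), `aux` (`n` qubits). -/
abbrev CompQubit (n : ℕ) : Type := Unit ⊕ (Fin n ⊕ Fin n)

abbrev CompQubit.out {n : ℕ} : CompQubit n := Sum.inl ()

abbrev CompQubit.adv {n : ℕ} (i : Fin n) : CompQubit n := Sum.inr (Sum.inl i)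

abbrev CompQubit.aux {n : ℕ} (i : Fin n) : CompQubit n := Sum.inr (Sum.inr i)

/-- The embedding of the `n` qubits of `C` as the `aux` register. -/
def auxEmb (n : ℕ) : Fin n ↪ CompQubit n :=
  ⟨CompQubit.aux, fun _ _ h => Sum.inr.inj (Sum.inr.inj h)⟩

open Classical in
/-- The Hadamard gate on the `out` qubit. -/
def hadamardOut (n : ℕ) : Matrix (CompQubit n → Bool) (CompQubit n → Bool) ℂ :=
  fun x y =>
    if ∀ i, i ≠ CompQubit.out → x i = y i then
      (1 / (√2 : ℝ) : ℂ) * (if x CompQubit.out && y CompQubit.out then -1 else 1)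
    else 0

/-- The NOT gate on the `out` qubit. -/
def notOut (n : ℕ) : Matrix (CompQubit n → Bool) (CompQubit n → Bool) ℂ :=
  fun x y => if x = Function.update y CompQubit.out (!y CompQubit.out) then 1 else 0

/-- The gate that swaps `adv i` and `aux i`, controlled by the `out` qubit. -/
def cswap {n : ℕ} (i : Fin n) : Matrix (CompQubit n → Bool) (CompQubit n → Bool) ℂ :=
  fun x y =>
    if x = (if y CompQubit.out then
        y ∘ Equiv.swap (CompQubit.adv i) (CompQubit.aux i) else y) then 1 else 0

/-- The gates of the comparison circuit, in order of application: `C` on `aux`, a Hadamard on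
`out`, the `n` controlled swaps, a Hadamard and a NOT on `out`. These are `T + n + 3` gates. -/
def comparisonGates {n : ℕ} (C : List (Gate (Fin n))) :
    List (Matrix (CompQubit n → Bool) (CompQubit n → Bool) ℂ) :=
  C.map (fun g => (g.map (auxEmb n)).toMatrix) ++ [hadamardOut n] ++ List.ofFn (fun i => cswap i) ++
    [hadamardOut n, notOut n]

/-- A basis state with the content of `adv` prescribed and with `out` and `aux` all zero. -/
def compInput {n : ℕ} (x : Fin n → Bool) : CompQubit n → Bool :=
  Sum.elim (fun _ => false) (Sum.elim x (fun _ => false))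

open Classical in
/-- The input `|0⟩_out |ψ⟩_adv |0…0⟩_aux`. -/
def inputState {n : ℕ} (ψ : (Fin n → Bool) → ℂ) : (CompQubit n → Bool) → ℂ :=
  fun y => if y = compInput (fun i => y (CompQubit.adv i))
    then ψ (fun i => y (CompQubit.adv i)) else 0

/-- Qubits of one message of the prover: `T' = n + T + 3` clock qubits and the qubits
of the comparison circuit. -/
abbrev MsgQubit (n T : ℕ) : Type := Fin (n + T + 3) ⊕ CompQubit n

/-- The unary clock value `j`: `j` ones followed by zeros. -/
def unary (m j : ℕ) : Fin m → Bool := fun i => decide (i.val < j)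

/-- The history state `(T'+1)^{-1/2} ∑_{j=0}^{T'} |j⟩_clock ⊗ G_j ⋯ G_1 |0⟩|ψ⟩|0…0⟩` of the
comparison circuit on the input `ψ`. -/
def historyState {n : ℕ} (C : List (Gate (Fin n))) (ψ : (Fin n → Bool) → ℂ) :
    (MsgQubit n C.length → Bool) → ℂ :=
  fun z => (1 / (√((n + C.length + 3 : ℕ) + 1 : ℝ) : ℝ) : ℂ) *
    ∑ j ∈ Finset.range (n + C.length + 3 + 1),
      if (fun i => z (Sum.inl i)) = unary (n + C.length + 3) j then
        applyAll ((comparisonGates C).take j) (inputState ψ) (fun i => z (Sum.inr i))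
      else 0

/-- The density matrix `|φ⟩⟨φ|`. -/
def pureState {B : Type} (φ : B → ℂ) : Matrix B B ℂ := Matrix.vecMulVec φ (star φ)

/-- Density matrices: positive semidefinite of trace one. -/
def IsDensity {B : Type} [Fintype B] (ρ : Matrix B B ℂ) : Prop :=
  ρ.PosSemidef ∧ ρ.trace = 1

/-! ### Receive-and-measure protocols -/

/-- The bases in which the verifier may measure a single qubit. -/
inductive PauliBasis
  | X
  | Y
  | Z

/-- The basis vector that belongs to an outcome (`false` for the eigenvalue `+1`, `true` for `-1`),
given by its two coordinates. -/
def PauliBasis.vec : PauliBasis → Bool → Bool → ℂ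
  | .Z, b, c => if c = b then 1 else 0
  | .X, b, c => (1 / (√2 : ℝ) : ℂ) * (if c then (if b then -1 else 1) else 1)
  | .Y, b, c => (1 / (√2 : ℝ) : ℂ) * (if c then (if b then -Complex.I else Complex.I) else 1)

/-- The product basis vector for the outcomes `b` when qubit `i` is measured in basis `β i`. -/
def prodVec {ι : Type} [Fintype ι] (β : ι → PauliBasis) (b x : ι → Bool) : ℂ :=
  ∏ i, (β i).vec (b i) (x i)

/-- Born's rule: the probability of the outcomes `b` when the qubits of a system in state `ρ` are
measured one by one, qubit `i` in basis `β i`. -/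
def born {ι : Type} [Fintype ι] [DecidableEq ι] (ρ : Matrix (ι → Bool) (ι → Bool) ℂ)
    (β : ι → PauliBasis) (b : ι → Bool) : ℝ :=
  (star (prodVec β b) ⬝ᵥ ρ *ᵥ prodVec β b).re

/-- The verifier of a receive-and-measure protocol with message qubits `ι` and with samples in
`{0,1}^n`. In each round it tosses classical coins, receives the qubits of the message one at
a time, and measures each one separately on arrival in a Pauli basis determined by the coins; so it
never stores more than one qubit and all it keeps is classical. After the last round it computes
from the classical record either `none` (reject) or `some S` (accept, with the samples `S`). -/
structure Verifier (ι : Type) (n : ℕ) where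
  rounds : ℕ
  Coin : Type
  fintypeCoin : Fintype Coin
  coinDist : Coin → ℝ
  coinDist_mem : coinDist ∈ stdSimplex ℝ Coin
  basis : Coin → ι → PauliBasis
  output : (Fin rounds → Coin × (ι → Bool)) → Option (List (Fin n → Bool))

attribute [instance] Verifier.fintypeCoin

/-- The probability that the output of the verifier lies in `E`, when the prover sends a fresh copy
of the state `ρ` in every round. -/
def Verifier.prob {ι : Type} [Fintype ι] [DecidableEq ι] {n : ℕ} (V : Verifier ι n)
    (ρ : Matrix (ι → Bool) (ι → Bool) ℂ) (E : Set (Option (List (Fin n → Bool)))) : ℝ :=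
  ∑ τ : Fin V.rounds → V.Coin × (ι → Bool),
    Set.indicator {τ | V.output τ ∈ E}
      (fun τ => ∏ r, V.coinDist (τ r).1 * born ρ (V.basis (τ r).1) (τ r).2) τ

/-- The samples are i.i.d. from `D`: given that the verifier accepts with `m` samples,
their joint law is the product law `D^m`, for every `m`. -/
def Verifier.SamplesIID {ι : Type} [Fintype ι] [DecidableEq ι] {n : ℕ} (V : Verifier ι n)
    (ρ : Matrix (ι → Bool) (ι → Bool) ℂ) (D : (Fin n → Bool) → ℝ) : Prop :=
  ∀ S : List (Fin n → Bool),
    V.prob ρ {some S} =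
      V.prob ρ {o | ∃ S' : List (Fin n → Bool), o = some S' ∧ S'.length = S.length} *
        (S.map D).prod

/-! ### The distribution `D^A` of a message -/

/-- The probability that measuring all the qubits of `ρ` in the `Z` basis gives zeros in `clock`,
`out` and `aux`, and `x` in `adv`. -/
def advWeight {n T : ℕ} (ρ : Matrix (MsgQubit n T → Bool) (MsgQubit n T → Bool) ℂ)
    (x : Fin n → Bool) : ℝ :=
  (ρ (Sum.elim (fun _ => false) (compInput x)) (Sum.elim (fun _ => false) (compInput x))).re

/-- The probability that `clock`, `out` and `aux` are all measured to be zero. -/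
def advProb {n T : ℕ} (ρ : Matrix (MsgQubit n T → Bool) (MsgQubit n T → Bool) ℂ) : ℝ :=
  ∑ x, advWeight ρ x

/-- `D^A`: the law of the content of `adv` when all the qubits of `ρ` are measured in the `Z` basis,
conditioned on `clock`, `out` and `aux` being all zero. -/
def advDist {n T : ℕ} (ρ : Matrix (MsgQubit n T → Bool) (MsgQubit n T → Bool) ℂ)
    (x : Fin n → Bool) : ℝ :=
  advWeight ρ x / advProb ρ

end QVerifier

end

noncomputable section

namespace QVerifier

/-! The comparison circuit is a swap test between the advice state and `U_C|0…0⟩`. The verifier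
estimates the energy of the prover's state under a Feynman–Kitaev clock Hamiltonian for it. Write `M
= T' + 1`. The Hamiltonian penalises an illegal clock value, a wrong `out` or `aux` at time 0, a
step that does not follow its gate, and, with weight `1/M`, the value 0 of `out` at the final time.
For a normalised advice state with overlap `f` the last event has probability `(1 - |f|²)/2` in the
circuit. The phase alignment makes `f = 1 - d_H²`, so the honest history state has energy at most `s
= η²/M²`; the acceptance threshold is `2s`.

No quantum memory is needed. A gate term is a local coherence between the clock values `j` and
`j+1`, and random Pauli outcomes, reweighted by the inverse of the single-qubit averaging map
(classical shadows), estimate it without bias (`mean_energyStat`). The estimate for gate `j`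
vanishes unless the clock reads `j` or `j+1`, so the importance weight of order `M` costs only a
factor `M`, not `M²`, in the second moment (`secondMoment_energyStat_le`). A Bernstein bound then
separates energy `s` from `3s` in `O(M log(1/δ)/s²) = O(M⁵ log(1/δ)/η⁴)` rounds, with constants
depending on the locality.

For soundness, acceptance with probability `2/3` forces energy at most `3s`. Write `ρ = ΦΦᴴ` and let
`v j` be the part of `Φ` at clock value `j`. By Cauchy–Schwarz every `v j` is within `√(6Ms) =
O(η/√M)` of the evolved `v 0`, and since the total mass is nearly 1, `‖v 0‖` is at least of order
`1/√M`. Hence the legal part of `v 0` fails the swap test with relative amplitude `O(η)`, and a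
Minkowski inequality turns the resulting overlap into a Hellinger distance at most `20η`
(`low_energy_sound`, `hellinger_le_of_overlap`), which is stronger than the claimed `η^{1/4}`. The
weight `1/M` on the output penalty is what allows a threshold this small: with weight 1 the
threshold would be of order `η²/M`, and the drift bound would exceed `‖v 0‖` for large `M`.

Samples come from all-`Z` rounds with zeros in clock, `out` and `aux`. The statistic is 0 in such a
round whatever `adv` contains, so neither the test, which depends only on the sum of the statistic,
nor the number of samples reveals anything about their values. Conditioned on both, the samples are
therefore exactly independent with law `D^A` (`samples_iid`). -/

open Classical in
/-- The indicator of a proposition. -/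
def ind (P : Prop) : ℝ := if P then 1 else 0

theorem ind_pos {P : Prop} (h : P) : ind P = 1 := if_pos h

theorem ind_neg {P : Prop} (h : ¬P) : ind P = 0 := if_neg h

theorem ind_nonneg (P : Prop) : 0 ≤ ind P := by
  unfold ind; split_ifs <;> norm_num

theorem ind_eq_ite (P : Prop) [Decidable P] : ind P = if P then 1 else 0 := by
  by_cases h : P
  · rw [ind_pos h, if_pos h]
  · rw [ind_neg h, if_neg h]

/-! ### Sums of independent bounded variables over a finite probability space -/

section Independent

variable {Ω : Type} [Fintype Ω]

theorem sum_prod_mul_prod (N : ℕ) (p f : Ω → ℝ) :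
    ∑ τ : Fin N → Ω, (∏ r, p (τ r)) * ∏ r, f (τ r) = (∑ ω, p ω * f ω) ^ N := by
  classical
  simp_rw [← Finset.prod_mul_distrib]
  rw [← Fintype.piFinset_univ, Finset.sum_prod_piFinset (g := fun _ ω => p ω * f ω)]
  simp

theorem sum_prod_eq_one (N : ℕ) {p : Ω → ℝ} (hp : ∑ ω, p ω = 1) :
    ∑ τ : Fin N → Ω, ∏ r, p (τ r) = 1 := by
  have h := sum_prod_mul_prod N p (fun _ => 1)
  simpa [hp] using h

/-- Average `exp x ≤ 1 + x + x²`, valid for `|x| ≤ 1`, then use `1 + y ≤ exp y`. The second moment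
enters, not the square of the range, which saves a factor of order `M` in the number of rounds. -/
theorem sum_mul_exp_le {p X : Ω → ℝ} (hp0 : ∀ ω, 0 ≤ p ω) (hp1 : ∑ ω, p ω = 1) {t V : ℝ}
    (ht : ∀ ω, |t * X ω| ≤ 1) (hV : ∑ ω, p ω * X ω ^ 2 ≤ V) :
    ∑ ω, p ω * Real.exp (t * X ω) ≤ Real.exp (t * ∑ ω, p ω * X ω + t ^ 2 * V) := by
  calc ∑ ω, p ω * Real.exp (t * X ω)
      ≤ ∑ ω, p ω * (1 + t * X ω + (t * X ω) ^ 2) := by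
        refine Finset.sum_le_sum fun ω _ => mul_le_mul_of_nonneg_left ?_ (hp0 ω)
        have := (abs_le.1 (Real.abs_exp_sub_one_sub_id_le (ht ω))).2
        linarith
    _ = 1 + t * ∑ ω, p ω * X ω + t ^ 2 * ∑ ω, p ω * X ω ^ 2 := by
        simp_rw [mul_add, mul_one, Finset.sum_add_distrib, hp1, Finset.mul_sum]
        congr 1
        · congr 1
          exact Finset.sum_congr rfl fun ω _ => by ring
        · exact Finset.sum_congr rfl fun ω _ => by ring
    _ ≤ (t * ∑ ω, p ω * X ω + t ^ 2 * V) + 1 := by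
        nlinarith [mul_le_mul_of_nonneg_left hV (sq_nonneg t)]
    _ ≤ _ := Real.add_one_le_exp _

/-- A Bernstein-type upper tail bound in terms of the second moment. -/
theorem upper_tail_le (N : ℕ) {p X : Ω → ℝ} (hp0 : ∀ ω, 0 ≤ p ω) (hp1 : ∑ ω, p ω = 1)
    {R V s μ : ℝ} (hR : ∀ ω, |X ω| ≤ R) (hV : ∑ ω, p ω * X ω ^ 2 ≤ V) (hV0 : 0 < V)
    (hs : 0 ≤ s) (hsR : s * R ≤ 2 * V) (hμ : ∑ ω, p ω * X ω ≤ μ) :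
    ∑ τ : Fin N → Ω, (∏ r, p (τ r)) * ind (N * (μ + s) ≤ ∑ r, X (τ r))
      ≤ Real.exp (-(N * (s ^ 2 / (4 * V)))) := by
  -- The minimiser of `-t * s + t ^ 2 * V`, with value `-s ^ 2 / (4 * V)`; `hsR` is exactly what
  -- keeps `|t * X|` at most 1.
  set t := s / (2 * V) with ht
  have ht0 : 0 ≤ t := by positivity
  have htX : ∀ ω, |t * X ω| ≤ 1 := fun ω => by
    rw [abs_mul, abs_of_nonneg ht0]
    calc t * |X ω| ≤ t * R := mul_le_mul_of_nonneg_left (hR ω) ht0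
      _ = s * R / (2 * V) := by rw [ht]; ring
      _ ≤ 1 := by rw [div_le_one (by positivity)]; exact hsR
  have hmgf := sum_mul_exp_le hp0 hp1 htX hV
  have hprod : ∀ τ : Fin N → Ω, 0 ≤ ∏ r, p (τ r) := fun τ => Finset.prod_nonneg fun r _ => hp0 _
  calc ∑ τ : Fin N → Ω, (∏ r, p (τ r)) * ind (N * (μ + s) ≤ ∑ r, X (τ r))
      ≤ ∑ τ : Fin N → Ω, Real.exp (-(t * (N * (μ + s)))) *
          ((∏ r, p (τ r)) * ∏ r, Real.exp (t * X (τ r))) := by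
        refine Finset.sum_le_sum fun τ _ => ?_
        rw [← Real.exp_sum, ← Finset.mul_sum]
        by_cases h : N * (μ + s) ≤ ∑ r, X (τ r)
        · rw [ind_pos h, mul_one, mul_left_comm, ← Real.exp_add]
          refine le_mul_of_one_le_right (hprod τ) (Real.one_le_exp ?_)
          nlinarith [mul_le_mul_of_nonneg_left h ht0]
        · have := hprod τ
          rw [ind_neg h, mul_zero]
          positivity
    _ = Real.exp (-(t * (N * (μ + s)))) * (∑ ω, p ω * Real.exp (t * X ω)) ^ N := by
        rw [← Finset.mul_sum, sum_prod_mul_prod N p (fun ω => Real.exp (t * X ω))]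
    _ ≤ Real.exp (-(t * (N * (μ + s)))) * Real.exp (t * μ + t ^ 2 * V) ^ N := by
        gcongr
        · exact Finset.sum_nonneg fun ω _ => mul_nonneg (hp0 ω) (Real.exp_pos _).le
        · refine hmgf.trans (Real.exp_le_exp.2 ?_)
          gcongr
    _ = _ := by
        rw [← Real.exp_nat_mul, ← Real.exp_add]
        congr 1
        rw [ht]
        field_simp
        ring

/-- The lower tail bound. -/
theorem lower_tail_le (N : ℕ) {p X : Ω → ℝ} (hp0 : ∀ ω, 0 ≤ p ω) (hp1 : ∑ ω, p ω = 1)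
    {R V s μ : ℝ} (hR : ∀ ω, |X ω| ≤ R) (hV : ∑ ω, p ω * X ω ^ 2 ≤ V) (hV0 : 0 < V)
    (hs : 0 ≤ s) (hsR : s * R ≤ 2 * V) (hμ : μ ≤ ∑ ω, p ω * X ω) :
    ∑ τ : Fin N → Ω, (∏ r, p (τ r)) * ind (∑ r, X (τ r) ≤ N * (μ - s))
      ≤ Real.exp (-(N * (s ^ 2 / (4 * V)))) := by
  have h := upper_tail_le N (X := fun ω => -X ω) (μ := -μ) hp0 hp1 (R := R) (V := V) (s := s)
    (by simpa using hR) (by simpa using hV) hV0 hs hsR (by simpa using hμ)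
  refine le_trans (le_of_eq (Finset.sum_congr rfl fun τ _ => ?_)) h
  rw [Finset.sum_neg_distrib]
  congr 2
  refine propext ⟨fun h => ?_, fun h => ?_⟩ <;> nlinarith

end Independent

/-! ### Samples extracted from independent rounds -/

section Samples

variable {Ω B : Type}

/-- The samples in a record of `N` rounds. -/
def samples (samp : Ω → Option B) {N : ℕ} (τ : Fin N → Ω) : List B :=
  (List.ofFn τ).filterMap samp

theorem samples_cons (samp : Ω → Option B) {N : ℕ} (ω : Ω) (τ : Fin N → Ω) :
    samples samp (Fin.cons ω τ : Fin (N + 1) → Ω) =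
      (samp ω).elim (samples samp τ) (fun x => x :: samples samp τ) := by
  simp only [samples, List.ofFn_succ, Fin.cons_zero, Fin.cons_succ, List.filterMap_cons]
  cases samp ω <;> rfl

theorem sum_fin_succ [Fintype Ω] (N : ℕ) (F : (Fin (N + 1) → Ω) → ℝ) :
    ∑ τ, F τ = ∑ ω, ∑ τ : Fin N → Ω, F (Fin.cons ω τ) := by
  rw [← (Fin.consEquiv (fun _ => Ω)).sum_comp, Fintype.sum_prod_type]
  rfl

theorem length_samples (samp : Ω → Option B) {N : ℕ} (τ : Fin N → Ω) :
    ((samples samp τ).length : ℝ) = ∑ r, ind ((samp (τ r)).isSome = true) := by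
  induction N with
  | zero => simp [samples]
  | succ N ih =>
    rw [← Fin.cons_self_tail τ, samples_cons, Fin.sum_univ_succ]
    simp only [Fin.cons_zero, Fin.cons_succ, ← ih]
    cases samp (τ 0) <;> simp [add_comm, ind]

/-- If the statistic `X` vanishes on the outcomes that give a sample, and a sample is `x` with
probability proportional to `D x`, then, given `∑ X` and the number of samples, the samples are
independent with law `D`. -/
theorem samples_iid [Fintype Ω] {p X : Ω → ℝ} {samp : Ω → Option B} {D : B → ℝ} {q : ℝ}
    (hX : ∀ ω x, samp ω = some x → X ω = 0)
    (hD : ∀ x, ∑ ω, p ω * ind (samp ω = some x) = q * D x)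
    (hq : ∑ ω, p ω * ind ((samp ω).isSome = true) = q) (N : ℕ) (h : ℝ → ℝ) (S : List B) :
    ∑ τ : Fin N → Ω, (∏ r, p (τ r)) * h (∑ r, X (τ r)) * ind (samples samp τ = S)
      = (∑ τ : Fin N → Ω, (∏ r, p (τ r)) * h (∑ r, X (τ r)) *
          ind ((samples samp τ).length = S.length)) * (S.map D).prod := by
  -- `h` is generalised because a first round without a sample shifts its argument by `X ω`, while a
  -- round with a sample leaves it unchanged by `hX` and removes the head of `S`.
  induction N generalizing h S with
  | zero => cases S <;> simp [samples, ind]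
  | succ N ih =>
    rw [sum_fin_succ, sum_fin_succ]
    simp only [Fin.prod_univ_succ, Fin.sum_univ_succ, Fin.cons_zero, Fin.cons_succ, samples_cons]
    have key : ∀ (u : List B → ℝ) (ω : Ω), ∑ τ : Fin N → Ω, (p ω * ∏ r, p (τ r)) *
          h (X ω + ∑ r, X (τ r)) * u ((samp ω).elim (samples samp τ)
            (fun x => x :: samples samp τ)) =
        ind (samp ω = none) * (p ω * ∑ τ : Fin N → Ω, (∏ r, p (τ r)) *
          h (X ω + ∑ r, X (τ r)) * u (samples samp τ)) +
        (samp ω).elim 0 (fun x => p ω * ∑ τ : Fin N → Ω, (∏ r, p (τ r)) *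
          h (∑ r, X (τ r)) * u (x :: samples samp τ)) := by
      intro u ω
      cases hω : samp ω with
      | none =>
        simp only [Option.elim, ind_pos, one_mul, add_zero, Finset.mul_sum]
        exact Finset.sum_congr rfl fun τ _ => by ring
      | some x =>
        rw [ind_neg (by simp), zero_mul, zero_add]
        simp only [Option.elim, hX ω x hω, zero_add, Finset.mul_sum]
        exact Finset.sum_congr rfl fun τ _ => by ring
    rw [Finset.sum_congr rfl fun ω _ => key (fun l => ind (l = S)) ω,
      Finset.sum_congr rfl fun ω _ => key (fun l => ind (l.length = S.length)) ω,
      Finset.sum_add_distrib, Finset.sum_add_distrib, add_mul, Finset.sum_mul]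
    congr 1
    · refine Finset.sum_congr rfl fun ω _ => ?_
      rw [ih (fun a => h (X ω + a)) S]
      ring
    · cases S with
      | nil =>
        have h0 : ∀ o : Option B, o.elim (0 : ℝ) (fun _ => 0) = 0 := fun o => by cases o <;> rfl
        simp [h0, ind]
      | cons y S =>
        simp only [List.cons.injEq, List.length_cons, Nat.add_right_cancel_iff, List.map_cons,
          List.prod_cons]
        set A := ∑ τ : Fin N → Ω, (∏ r, p (τ r)) * h (∑ r, X (τ r)) *
          ind ((samples samp τ).length = S.length) with hA
        have e1 : ∀ ω, ((samp ω).elim 0 fun x => p ω * ∑ τ : Fin N → Ω, (∏ r, p (τ r)) *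
            h (∑ r, X (τ r)) * ind (x = y ∧ samples samp τ = S)) =
            p ω * ind (samp ω = some y) * (A * (S.map D).prod) := by
          intro ω
          cases hω : samp ω with
          | none => simp [ind]
          | some x =>
            by_cases hxy : x = y
            · simp only [Option.elim, hxy, true_and, ind_pos, mul_one, ih h S, hA]
            · simp [hxy, ind]
        have e2 : ∀ ω, ((samp ω).elim 0 fun x => p ω * A) =
            p ω * ind ((samp ω).isSome = true) * A := by
          intro ω
          cases samp ω <;> simp [ind]
        simp_rw [e1, e2]
        rw [← Finset.sum_mul, ← Finset.sum_mul, hD, hq]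
        ring

end Samples

end QVerifier

end

noncomputable section

namespace QVerifier

/-! ### Estimating local observables by measurements in random Pauli bases -/

instance : DecidableEq PauliBasis := fun a b => by
  cases a <;> cases b <;> first | exact isTrue rfl | exact isFalse nofun

instance : Fintype PauliBasis where
  elems := {.X, .Y, .Z}
  complete := fun a => by cases a <;> simp

theorem card_pauliBasis : Fintype.card PauliBasis = 3 := rfl

theorem sum_pauliBasis {M : Type*} [AddCommMonoid M] (f : PauliBasis → M) :
    ∑ p, f p = f .X + f .Y + f .Z := by
  have : (Finset.univ : Finset PauliBasis) = {.X, .Y, .Z} := rfl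
  rw [this, Finset.sum_insert (by simp), Finset.sum_pair (by simp), add_assoc]

theorem inv_sqrt_two_mul_self : ((√2 : ℝ) : ℂ)⁻¹ * ((√2 : ℝ) : ℂ)⁻¹ = 1 / 2 := by
  rw [← mul_inv, ← Complex.ofReal_mul, Real.mul_self_sqrt (by norm_num)]
  norm_num

/-- The weight that a measurement outcome has in the expansion of a matrix unit of one qubit. -/
def shadowWeight (p : PauliBasis) (c a a' : Bool) : ℂ :=
  p.vec c a * star (p.vec c a') - if a = a' then 1 / 3 else 0

/-- The entries of the projections onto the basis vectors. -/
def pauliProj : PauliBasis → Bool → Bool → Bool → ℂ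
  | .Z, c, a, a' => if a = c ∧ a' = c then 1 else 0
  | .X, c, a, a' => if a = a' then 1 / 2 else if c then -1 / 2 else 1 / 2
  | .Y, c, a, a' => if a = a' then 1 / 2 else if a = c then -Complex.I / 2 else Complex.I / 2

theorem vec_mul_star_vec (p : PauliBasis) (c a a' : Bool) :
    p.vec c a * star (p.vec c a') = pauliProj p c a a' := by
  have h := inv_sqrt_two_mul_self
  have hI := Complex.I_mul_I
  cases p <;> cases c <;> cases a <;> cases a' <;> simp [PauliBasis.vec, pauliProj] <;>
    first
    | linear_combination h
    | linear_combination -h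
    | linear_combination Complex.I * h
    | linear_combination -Complex.I * h
    | linear_combination (-Complex.I * Complex.I) * h - hI / 2

theorem star_vec_mul_vec (p : PauliBasis) (c a a' : Bool) :
    star (p.vec c a) * p.vec c a' = pauliProj p c a' a := by
  rw [mul_comm, vec_mul_star_vec]

theorem sum_vec (p : PauliBasis) (x y : Bool) :
    ∑ c, star (p.vec c x) * p.vec c y = if x = y then 1 else 0 := by
  simp_rw [star_vec_mul_vec]
  cases p <;> cases x <;> cases y <;> simp [pauliProj] <;> ring

theorem sum_vec_Z (d x y : Bool) :
    ∑ c, (if c = d then (1 : ℂ) else 0) * (star (PauliBasis.Z.vec c x) * PauliBasis.Z.vec c y) =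
      if x = d ∧ y = d then 1 else 0 := by
  cases d <;> cases x <;> cases y <;> simp [PauliBasis.vec]

/-- The six Pauli eigenvectors form a 2-design: their `|v⟩⟨v| ⊗ |v⟩⟨v|` add up to the identity plus
the swap. The `1/3` in `shadowWeight` removes the identity part, so what remains reads off a single
matrix unit. The estimator carries an extra factor 3 to undo the probability `1/3` of each basis. -/
theorem sum_shadowWeight (a a' x y : Bool) :
    ∑ p : PauliBasis, ∑ c, shadowWeight p c a a' * (star (p.vec c x) * p.vec c y) =
      if x = a ∧ y = a' then 1 else 0 := by
  have hI := Complex.I_mul_I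
  rw [sum_pauliBasis]
  simp_rw [shadowWeight, star_vec_mul_vec, vec_mul_star_vec]
  cases a <;> cases a' <;> cases x <;> cases y <;> simp [pauliProj] <;>
    first
    | ring1
    | linear_combination hI / 2
    | linear_combination -hI / 2

theorem norm_shadowWeight_le (p : PauliBasis) (c a a' : Bool) : ‖shadowWeight p c a a'‖ ≤ 1 := by
  rw [shadowWeight, vec_mul_star_vec]
  cases p <;> cases c <;> cases a <;> cases a' <;> simp [pauliProj] <;> norm_num

/-! ### Born's rule for product measurements and the expectation of product statistics. -/

section Born

variable {ι : Type} [Fintype ι] [DecidableEq ι]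

theorem sum_prodVec_mul (β : ι → PauliBasis) (f : ι → Bool → ℂ) (x y : ι → Bool) :
    ∑ b : ι → Bool, (∏ i, f i (b i)) * (star (prodVec β b x) * prodVec β b y) =
      ∏ i, ∑ c, f i c * (star ((β i).vec c (x i)) * (β i).vec c (y i)) := by
  rw [Finset.prod_univ_sum, Fintype.piFinset_univ]
  refine Finset.sum_congr rfl fun b _ => ?_
  simp only [prodVec, star_prod, Finset.prod_mul_distrib]

theorem sum_basis_prodVec_mul (f : ι → PauliBasis → Bool → ℂ) (x y : ι → Bool) :
    ∑ β : ι → PauliBasis, ∑ b : ι → Bool,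
        (∏ i, f i (β i) (b i)) * (star (prodVec β b x) * prodVec β b y) =
      ∏ i, ∑ p, ∑ c, f i p c * (star (p.vec c (x i)) * p.vec c (y i)) := by
  rw [Finset.prod_univ_sum, Fintype.piFinset_univ]
  exact Finset.sum_congr rfl fun β _ => sum_prodVec_mul β (fun i => f i (β i)) x y

variable {ρ : Matrix (ι → Bool) (ι → Bool) ℂ}

theorem ofReal_born (hρ : ρ.IsHermitian) (β : ι → PauliBasis) (b : ι → Bool) :
    (born ρ β b : ℂ) = ∑ x, ∑ y, ρ x y * (star (prodVec β b x) * prodVec β b y) := by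
  have h : star (prodVec β b) ⬝ᵥ ρ *ᵥ prodVec β b =
      ∑ x, ∑ y, ρ x y * (star (prodVec β b x) * prodVec β b y) := by
    simp only [dotProduct, Matrix.mulVec, Finset.mul_sum, Pi.star_apply]
    exact Finset.sum_congr rfl fun x _ => Finset.sum_congr rfl fun y _ => by ring
  rw [← h]
  apply Complex.ext
  · simp [born]
  · have := hρ.im_star_dotProduct_mulVec_self (prodVec β b)
    simpa using this.symm

theorem born_nonneg (hρ : ρ.PosSemidef) (β : ι → PauliBasis) (b : ι → Bool) :
    0 ≤ born ρ β b :=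
  hρ.re_dotProduct_nonneg (prodVec β b)

theorem sum_mul_born (hρ : ρ.IsHermitian) (g : (ι → PauliBasis) → (ι → Bool) → ℂ) :
    ∑ β, ∑ b, g β b * (born ρ β b : ℂ) = ∑ x, ∑ y, ρ x y *
      ∑ β, ∑ b, g β b * (star (prodVec β b x) * prodVec β b y) := by
  simp_rw [ofReal_born hρ, Finset.mul_sum]
  rw [Finset.sum_congr rfl fun β _ => Finset.sum_comm, Finset.sum_comm]
  refine Finset.sum_congr rfl fun x _ => ?_
  rw [Finset.sum_congr rfl fun β _ => Finset.sum_comm, Finset.sum_comm]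
  exact Finset.sum_congr rfl fun y _ => Finset.sum_congr rfl fun β _ =>
    Finset.sum_congr rfl fun b _ => by ring

/-- The expectation of a product statistic. -/
theorem sum_prod_mul_born (hρ : ρ.IsHermitian) (f : ι → PauliBasis → Bool → ℂ) :
    ∑ β : ι → PauliBasis, ∑ b, (∏ i, f i (β i) (b i)) * (born ρ β b : ℂ) = ∑ x, ∑ y, ρ x y *
      ∏ i, ∑ p, ∑ c, f i p c * (star (p.vec c (x i)) * p.vec c (y i)) := by
  rw [sum_mul_born hρ fun β b => ∏ i, f i (β i) (b i)]
  simp_rw [sum_basis_prodVec_mul]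

theorem sum_born (hρ : ρ.IsHermitian) (β : ι → PauliBasis) :
    ∑ b, born ρ β b = ρ.trace.re := by
  have h : ∀ x y, ∑ b, star (prodVec β b x) * prodVec β b y = if x = y then 1 else 0 := by
    intro x y
    have := sum_prodVec_mul β (fun _ _ => 1) x y
    simp only [Finset.prod_const_one, one_mul] at this
    simp_rw [this, sum_vec, Fintype.prod_ite_zero, ← funext_iff]
    simp
  have h2 : ((∑ b, born ρ β b : ℝ) : ℂ) = ρ.trace := by
    push_cast
    simp_rw [ofReal_born hρ]
    rw [Finset.sum_comm]
    simp_rw [Finset.sum_comm (s := (Finset.univ : Finset (ι → Bool))) (t := Finset.univ)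
      (f := fun b y => ρ _ y * (star (prodVec β b _) * prodVec β b y)), ← Finset.mul_sum, h]
    simp [Matrix.trace]
  rw [← h2, Complex.ofReal_re]

theorem born_Z (b : ι → Bool) : born ρ (fun _ => .Z) b = (ρ b b).re := by
  have h : prodVec (fun _ : ι => PauliBasis.Z) b = Pi.single b 1 := by
    ext x
    simp only [prodVec, PauliBasis.vec, Pi.single_apply, Fintype.prod_ite_zero, funext_iff]
    simp
  rw [born, h, ← Pi.single_star]
  simp

end Born

/-! ### Local operators -/

section Local

variable {ι : Type} [DecidableEq ι]

/-- The basis state that equals `x` on `W` and is zero elsewhere. -/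
def cut (W : Finset ι) (x : ι → Bool) : ι → Bool := fun i => if i ∈ W then x i else false

/-- Extension by zero of an assignment on `W`. -/
def extendZero (W : Finset ι) (a : W → Bool) : ι → Bool :=
  fun i => if h : i ∈ W then a ⟨i, h⟩ else false

theorem extendZero_restrict (W : Finset ι) (x : ι → Bool) :
    extendZero W (fun i => x i) = cut W x := by
  ext i; simp [extendZero, cut]

open Classical in
/-- `A` acts on the qubits in `W` only. -/
def IsLocalOn (W : Finset ι) (A : Matrix (ι → Bool) (ι → Bool) ℂ) : Prop :=
  ∀ x y, A x y = if ∀ i, i ∉ W → x i = y i then A (cut W x) (cut W y) else 0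

variable [Fintype ι]

/-- An expansion in matrix units on `W`, tensored with the identity elsewhere: only the restrictions
of `x` and `y` to `W` survive. The transposed entry `A y x` is the one paired with `ρ x y` in a
trace. -/
theorem IsLocalOn.sum_eq {W : Finset ι} {A : Matrix (ι → Bool) (ι → Bool) ℂ}
    (hA : IsLocalOn W A) (x y : ι → Bool) :
    ∑ a : W → Bool, ∑ a' : W → Bool, A (extendZero W a') (extendZero W a) *
      ∏ i, (if i ∈ W then (if x i = extendZero W a i ∧ y i = extendZero W a' i then 1 else 0)
        else (if x i = y i then 1 else 0)) = A y x := by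
  classical
  have hne : ∀ (z : ι → Bool) (a : W → Bool), a ≠ (fun i : W => z i) →
      ∃ i ∈ W, z i ≠ extendZero W a i := by
    intro z a h
    obtain ⟨i, hi⟩ := Function.ne_iff.1 h
    exact ⟨i, i.2, by simpa [extendZero] using fun h => hi h.symm⟩
  rw [Finset.sum_eq_single (fun i : W => x i), Finset.sum_eq_single (fun i : W => y i)]
  · rw [extendZero_restrict, extendZero_restrict, hA y x]
    have : ∀ i, (if i ∈ W then (if x i = cut W x i ∧ y i = cut W y i then (1 : ℂ) else 0)
        else (if x i = y i then 1 else 0)) = if i ∉ W → y i = x i then 1 else 0 := by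
      intro i
      by_cases hi : i ∈ W <;> simp [hi, cut, eq_comm]
    simp_rw [this, Fintype.prod_ite_zero]
    simp
  · intro a' _ h
    obtain ⟨i, hi, hne⟩ := hne y a' h
    rw [Finset.prod_eq_zero (Finset.mem_univ i) (by simp [hi, hne]), mul_zero]
  · simp
  · intro a _ h
    obtain ⟨i, hi, hne⟩ := hne x a h
    refine Finset.sum_eq_zero fun a' _ => ?_
    rw [Finset.prod_eq_zero (Finset.mem_univ i) (by simp [hi, hne]), mul_zero]
  · simp

/-- The estimator for a local operator from outcomes in random Pauli bases. -/
def localEst (W : Finset ι) (A : Matrix (ι → Bool) (ι → Bool) ℂ) (β : ι → PauliBasis)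
    (b : ι → Bool) : ℂ :=
  ∑ a : W → Bool, ∑ a' : W → Bool, A (extendZero W a') (extendZero W a) *
    ∏ i, (if i ∈ W then 3 * shadowWeight (β i) (b i) (extendZero W a i) (extendZero W a' i) else 1)

/-- There are `4 ^ W.card` terms, each at most `3 ^ W.card`; a gate of bounded locality therefore
has a bounded estimator. -/
theorem norm_localEst_le {W : Finset ι} {A : Matrix (ι → Bool) (ι → Bool) ℂ}
    (hA : ∀ x y, ‖A x y‖ ≤ 1) (β : ι → PauliBasis) (b : ι → Bool) :
    ‖localEst W A β b‖ ≤ 12 ^ W.card := by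
  have h : ∀ a a' : W → Bool, ‖A (extendZero W a') (extendZero W a) * ∏ i, (if i ∈ W then
      3 * shadowWeight (β i) (b i) (extendZero W a i) (extendZero W a' i) else 1)‖ ≤
      3 ^ W.card := by
    intro a a'
    rw [norm_mul, norm_prod]
    have h1 : ∏ i, ‖if i ∈ W then
        3 * shadowWeight (β i) (b i) (extendZero W a i) (extendZero W a' i) else 1‖ ≤
        ∏ i, if i ∈ W then (3 : ℝ) else 1 := by
      refine Finset.prod_le_prod (fun _ _ => norm_nonneg _) fun i _ => ?_
      split_ifs
      · rw [norm_mul]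
        have := norm_shadowWeight_le (β i) (b i) (extendZero W a i) (extendZero W a' i)
        norm_num
        linarith
      · simp
    have h2 : ∏ i, (if i ∈ W then (3 : ℝ) else 1) = 3 ^ W.card := by
      rw [Finset.prod_ite_mem]; simp
    rw [h2] at h1
    calc _ ≤ 1 * (3 : ℝ) ^ W.card :=
          mul_le_mul (hA _ _) h1 (Finset.prod_nonneg fun _ _ => norm_nonneg _) zero_le_one
      _ = _ := one_mul _
  refine (norm_sum_le _ _).trans ?_
  refine (Finset.sum_le_sum fun a _ => (norm_sum_le _ _).trans
    (Finset.sum_le_sum fun a' _ => h a a')).trans ?_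
  simp only [Finset.sum_const, Finset.card_univ, Fintype.card_fun, Fintype.card_bool,
    Fintype.card_coe, nsmul_eq_mul]
  push_cast
  rw [← mul_assoc, ← mul_pow, ← mul_pow]
  norm_num

end Local

end QVerifier

end

noncomputable section

namespace QVerifier

/-! ### Gates -/

section GateOperators

variable {ι : Type} {m : ℕ}

open Classical in
/-- The operator `U` on the wires `w`, tensored with the identity. -/
def liftOp (w : Fin m ↪ ι) (U : Matrix (Fin m → Bool) (Fin m → Bool) ℂ) :
    Matrix (ι → Bool) (ι → Bool) ℂ :=
  fun x y => if ∀ i, i ∉ Set.range w → x i = y i then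
    U (fun a => x (w a)) (fun a => y (w a)) else 0

theorem Gate.toMatrix_eq (g : Gate ι) : g.toMatrix = liftOp g.wires g.op := rfl

theorem Gate.toMatrix_map {κ : Type} (f : ι ↪ κ) (g : Gate ι) :
    (g.map f).toMatrix = liftOp (g.wires.trans f) g.op := rfl

theorem liftOp_conjTranspose (w : Fin m ↪ ι) (U : Matrix (Fin m → Bool) (Fin m → Bool) ℂ) :
    (liftOp w U)ᴴ = liftOp w Uᴴ := by
  classical
  ext x y
  simp only [liftOp, Matrix.conjTranspose_apply, apply_ite star, star_zero]
  exact if_congr (forall₂_congr fun _ _ => eq_comm) rfl rfl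

theorem extend_not_mem (w : Fin m ↪ ι) (u : Fin m → Bool) (x : ι → Bool) {i : ι}
    (hi : i ∉ Set.range w) : Function.extend w u x i = x i :=
  Function.extend_apply' _ _ _ (by simpa using hi)

theorem isLocalOn_liftOp [DecidableEq ι] (w : Fin m ↪ ι)
    (U : Matrix (Fin m → Bool) (Fin m → Bool) ℂ) :
    IsLocalOn (Finset.univ.map w) (liftOp w U) := by
  classical
  intro x y
  have h : ∀ i, i ∉ Finset.univ.map w ↔ i ∉ Set.range w := by simp
  have hc : ∀ (z : ι → Bool) a, cut (Finset.univ.map w) z (w a) = z (w a) := by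
    intro z a; simp [cut]
  simp only [liftOp, hc, h]
  rw [if_pos (c := ∀ i, i ∉ Set.range w → cut _ x i = cut _ y i)]
  intro i hi
  simp [cut, (h i).2 hi]

variable [Fintype ι] [DecidableEq ι]

/-- The states agreeing with `x` off the wires are exactly those obtained by overwriting the wires
of `x` with some `u`. -/
theorem liftOp_mulVec (w : Fin m ↪ ι) (U : Matrix (Fin m → Bool) (Fin m → Bool) ℂ)
    (v : (ι → Bool) → ℂ) (x : ι → Bool) :
    (liftOp w U *ᵥ v) x = ∑ u : Fin m → Bool, U (x ∘ w) u * v (Function.extend w u x) := by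
  classical
  simp only [Matrix.mulVec, dotProduct, liftOp, ite_mul, zero_mul]
  rw [← Finset.sum_filter]
  symm
  refine Finset.sum_bij' (fun u _ => Function.extend w u x) (fun y _ => y ∘ w) ?_ ?_ ?_ ?_ ?_
  · intro u _
    simp only [Finset.mem_filter, Finset.mem_univ, true_and]
    intro i hi
    rw [extend_not_mem _ _ _ hi]
  · simp
  · intro u _
    exact Function.extend_comp w.injective _ _
  · intro y hy
    simp only [Finset.mem_filter, Finset.mem_univ, true_and] at hy
    ext i
    by_cases hi : i ∈ Set.range w
    · obtain ⟨a, rfl⟩ := hi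
      rw [w.injective.extend_apply]
      rfl
    · rw [extend_not_mem _ _ _ hi, hy i hi]
  · intro u _
    simp only [w.injective.extend_apply]
    rfl

/-- Overwriting the wires twice forgets the first content, so the product of the two lifted
operators reduces to the small product `Uᴴ U = 1`. -/
theorem liftOp_mem_unitaryGroup (w : Fin m ↪ ι) {U : Matrix (Fin m → Bool) (Fin m → Bool) ℂ}
    (hU : U ∈ Matrix.unitaryGroup (Fin m → Bool) ℂ) :
    liftOp w U ∈ Matrix.unitaryGroup (ι → Bool) ℂ := by
  rw [Matrix.mem_unitaryGroup_iff', Matrix.star_eq_conjTranspose] at hU ⊢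
  rw [liftOp_conjTranspose]
  apply Matrix.ext_of_mulVec_single
  intro j
  generalize (Pi.single j 1 : (ι → Bool) → ℂ) = v
  rw [Matrix.one_mulVec, ← Matrix.mulVec_mulVec]
  ext x
  simp_rw [liftOp_mulVec, Finset.mul_sum]
  rw [Finset.sum_comm]
  have hw : ∀ (u u' : Fin m → Bool), Function.extend w u' (Function.extend w u x) =
      Function.extend w u' x := by
    intro u u'
    ext i
    by_cases hi : i ∈ Set.range w
    · obtain ⟨a, rfl⟩ := hi
      simp only [w.injective.extend_apply]
    · simp only [extend_not_mem _ _ _ hi]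
  have hc : ∀ u : Fin m → Bool, (Function.extend w u x) ∘ w = u :=
    fun u => Function.extend_comp w.injective _ _
  simp_rw [hw, hc, ← mul_assoc, ← Finset.sum_mul, ← Matrix.mul_apply, hU, Matrix.one_apply,
    ite_mul, one_mul, zero_mul]
  rw [Finset.sum_ite_eq, if_pos (Finset.mem_univ _)]
  congr 1
  ext i
  by_cases hi : i ∈ Set.range w
  · obtain ⟨a, rfl⟩ := hi
    simp only [w.injective.extend_apply, Function.comp]
  · rw [extend_not_mem _ _ _ hi]

end GateOperators

/-! ### The gates of the comparison circuit -/

section ComparisonGates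

variable {n : ℕ}

theorem hadamardOut_mulVec (v : (CompQubit n → Bool) → ℂ) (x : CompQubit n → Bool) :
    (hadamardOut n *ᵥ v) x = ((√2 : ℝ) : ℂ)⁻¹ * (v (Function.update x CompQubit.out false) +
      (if x CompQubit.out then -1 else 1) * v (Function.update x CompQubit.out true)) := by
  classical
  have hne : Function.update x CompQubit.out false ≠ Function.update x CompQubit.out true := by
    intro h
    simpa using congrFun h CompQubit.out
  have hfilter : (Finset.univ.filter fun y : CompQubit n → Bool =>
      ∀ i, i ≠ CompQubit.out → x i = y i) =
      {Function.update x CompQubit.out false, Function.update x CompQubit.out true} := by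
    ext y
    simp only [Finset.mem_filter, Finset.mem_univ, true_and, Finset.mem_insert,
      Finset.mem_singleton, Function.eq_update_iff]
    constructor
    · intro h
      cases hy : y CompQubit.out
      · exact Or.inl ⟨rfl, fun i hi => (h i hi).symm⟩
      · exact Or.inr ⟨rfl, fun i hi => (h i hi).symm⟩
    · rintro (h | h) i hi
      exacts [(h.2 i hi).symm, (h.2 i hi).symm]
  simp only [Matrix.mulVec, dotProduct, hadamardOut, ite_mul, zero_mul]
  rw [← Finset.sum_filter, hfilter, Finset.sum_pair hne]
  cases x CompQubit.out <;> simp <;> ring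

theorem hadamardOut_mem_unitaryGroup (n : ℕ) :
    hadamardOut n ∈ Matrix.unitaryGroup (CompQubit n → Bool) ℂ := by
  have hstar : star (hadamardOut n) = hadamardOut n := by
    ext x y
    rw [Matrix.star_apply, hadamardOut, hadamardOut, apply_ite star, star_zero]
    refine if_congr (by simp [eq_comm]) ?_ rfl
    rw [Bool.and_comm]
    split_ifs <;> simp
  rw [Matrix.mem_unitaryGroup_iff', hstar]
  apply Matrix.ext_of_mulVec_single
  intro j
  generalize (Pi.single j 1 : (CompQubit n → Bool) → ℂ) = v
  rw [Matrix.one_mulVec, ← Matrix.mulVec_mulVec]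
  ext x
  have h := inv_sqrt_two_mul_self
  simp only [hadamardOut_mulVec, Function.update_idem, Function.update_self]
  cases hx : x CompQubit.out
  · have : Function.update x CompQubit.out false = x := by rw [← hx, Function.update_eq_self]
    rw [this]
    simp
    linear_combination (2 * v x) * h
  · have : Function.update x CompQubit.out true = x := by rw [← hx, Function.update_eq_self]
    rw [this]
    simp
    linear_combination (2 * v x) * h

theorem involution_mem_unitaryGroup {B : Type} [Fintype B] [DecidableEq B] {f : B → B}
    (hf : Function.Involutive f) {A : Matrix B B ℂ}
    (hA : ∀ x y, A x y = if x = f y then 1 else 0) : A ∈ Matrix.unitaryGroup B ℂ := by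
  rw [Matrix.mem_unitaryGroup_iff']
  ext x y
  simp [Matrix.mul_apply, Matrix.star_apply, hA, Matrix.one_apply, hf.injective.eq_iff, eq_comm]

theorem involution_mulVec {B : Type} [Fintype B] [DecidableEq B] {f : B → B}
    (hf : Function.Involutive f) {A : Matrix B B ℂ}
    (hA : ∀ x y, A x y = if x = f y then 1 else 0) (v : B → ℂ) (x : B) :
    (A *ᵥ v) x = v (f x) := by
  simp only [Matrix.mulVec, dotProduct, hA, ite_mul, one_mul, zero_mul]
  rw [Finset.sum_eq_single (f x)]
  · simp [hf x]
  · intro y _ hy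
    rw [if_neg]
    rintro rfl
    exact hy (hf y).symm
  · simp

/-- Negation of the `out` qubit. -/
def flipOut (y : CompQubit n → Bool) : CompQubit n → Bool :=
  Function.update y CompQubit.out (!y CompQubit.out)

theorem flipOut_involutive : Function.Involutive (flipOut (n := n)) := by
  intro y
  simp [flipOut]

/-- The exchange of `adv i` and `aux i` controlled by `out`. -/
def condSwap (i : Fin n) (y : CompQubit n → Bool) : CompQubit n → Bool :=
  if y CompQubit.out then y ∘ Equiv.swap (CompQubit.adv i) (CompQubit.aux i) else y

theorem condSwap_out (i : Fin n) (y : CompQubit n → Bool) :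
    condSwap i y CompQubit.out = y CompQubit.out := by
  unfold condSwap
  split_ifs
  · simp [Equiv.swap_apply_of_ne_of_ne]
  · rfl

theorem condSwap_involutive (i : Fin n) : Function.Involutive (condSwap i) := by
  intro y
  have h := condSwap_out i y
  rw [condSwap, h]
  unfold condSwap
  split_ifs
  · ext j
    simp
  · rfl

theorem isLocalOn_hadamardOut (n : ℕ) : IsLocalOn {CompQubit.out} (hadamardOut n) := by
  intro x y
  have h : ∀ z : CompQubit n → Bool, cut {CompQubit.out} z CompQubit.out = z CompQubit.out := by
    intro z; simp [cut]
  simp only [hadamardOut, h, Finset.mem_singleton]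
  rw [if_pos (c := ∀ i, i ≠ CompQubit.out → cut _ x i = cut _ y i)]
  · intro i hi
    simp only [cut, Finset.mem_singleton, if_neg hi]

theorem isLocalOn_notOut (n : ℕ) : IsLocalOn {CompQubit.out} (notOut n) := by
  intro x y
  simp only [notOut, Function.eq_update_iff, Finset.mem_singleton]
  by_cases h : ∀ i, i ≠ CompQubit.out → x i = y i
  · rw [if_pos (c := ∀ i, ¬ i = CompQubit.out → x i = y i) h]
    refine if_congr ?_ rfl rfl
    simp only [cut, Finset.mem_singleton, if_true]
    refine and_congr_right fun _ => iff_of_true h fun i hi => ?_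
    rw [if_neg hi, if_neg hi]
  · rw [if_neg (c := ∀ i, ¬ i = CompQubit.out → x i = y i) h, if_neg fun h' => h h'.2]

theorem isLocalOn_cswap (i : Fin n) :
    IsLocalOn {CompQubit.out, CompQubit.adv i, CompQubit.aux i} (cswap i) := by
  intro x y
  set W : Finset (CompQubit n) := {CompQubit.out, CompQubit.adv i, CompQubit.aux i} with hW
  have hout : cut W y CompQubit.out = y CompQubit.out := by simp [cut, hW]
  have hmem : ∀ j, j ∉ W → j ≠ CompQubit.adv i ∧ j ≠ CompQubit.aux i := by
    intro j hj
    simp only [hW, Finset.mem_insert, Finset.mem_singleton, not_or] at hj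
    exact hj.2
  have hsw : ∀ j, Equiv.swap (CompQubit.adv i) (CompQubit.aux i) j ∈ W ↔ j ∈ W := by
    intro j
    by_cases h1 : j = CompQubit.adv i
    · subst h1; simp [hW]
    by_cases h2 : j = CompQubit.aux i
    · subst h2; simp [hW]
    rw [Equiv.swap_apply_of_ne_of_ne h1 h2]
  simp only [cswap, hout]
  by_cases h : ∀ j, j ∉ W → x j = y j
  · rw [if_pos h]
    refine if_congr ?_ rfl rfl
    cases y CompQubit.out
    · simp only [Bool.false_eq_true, if_false]
      rw [funext_iff, funext_iff]
      refine forall_congr' fun j => ?_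
      by_cases hj : j ∈ W
      · simp [cut, hj]
      · simp [cut, hj, h j hj]
    · simp only [if_true]
      rw [funext_iff, funext_iff]
      refine forall_congr' fun j => ?_
      by_cases hj : j ∈ W
      · simp [cut, hj, hsw]
      · simp [cut, hj, Equiv.swap_apply_of_ne_of_ne (hmem j hj).1 (hmem j hj).2, h j hj]
  · rw [if_neg h, if_neg]
    rintro rfl
    refine h fun j hj => ?_
    split_ifs
    · simp [Equiv.swap_apply_of_ne_of_ne (hmem j hj).1 (hmem j hj).2]
    · rfl

theorem notOut_apply (x y : CompQubit n → Bool) :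
    notOut n x y = if x = flipOut y then 1 else 0 := rfl

theorem cswap_apply (i : Fin n) (x y : CompQubit n → Bool) :
    cswap i x y = if x = condSwap i y then 1 else 0 := rfl

theorem length_comparisonGates (C : List (Gate (Fin n))) :
    (comparisonGates C).length = n + C.length + 3 := by
  simp [comparisonGates]
  ring

/-- The bound `k + 3` covers at once the gates of the circuit, of arity at most `k`, and the
controlled swaps on three qubits. -/
theorem mem_comparisonGates {C : List (Gate (Fin n))} {k : ℕ} (hC : ∀ g ∈ C, g.arity ≤ k)
    {A : Matrix (CompQubit n → Bool) (CompQubit n → Bool) ℂ} (hA : A ∈ comparisonGates C) :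
    A ∈ Matrix.unitaryGroup (CompQubit n → Bool) ℂ ∧
      ∃ W : Finset (CompQubit n), W.card ≤ k + 3 ∧ IsLocalOn W A := by
  simp only [comparisonGates, List.append_assoc, List.cons_append, List.nil_append,
    List.mem_append, List.mem_map, List.mem_cons, List.mem_ofFn, List.not_mem_nil, or_false] at hA
  rcases hA with ⟨g, hg, rfl⟩ | rfl | ⟨i, rfl⟩ | rfl | rfl
  · rw [Gate.toMatrix_map]
    refine ⟨liftOp_mem_unitaryGroup _ g.op.2, _, ?_, isLocalOn_liftOp _ _⟩
    have := hC g hg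
    simp only [Finset.card_map, Finset.card_univ, Fintype.card_fin]
    omega
  · exact ⟨hadamardOut_mem_unitaryGroup n, _, by simp, isLocalOn_hadamardOut n⟩
  · exact ⟨involution_mem_unitaryGroup (condSwap_involutive i) (cswap_apply i), _,
      (Finset.card_le_three).trans (by omega), isLocalOn_cswap i⟩
  · exact ⟨hadamardOut_mem_unitaryGroup n, _, by simp, isLocalOn_hadamardOut n⟩
  · exact ⟨involution_mem_unitaryGroup flipOut_involutive notOut_apply, _, by simp,
      isLocalOn_notOut n⟩

end ComparisonGates

/-! ### The swap test -/

section SwapTest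

variable {n : ℕ}

theorem applyAll_append {B : Type} [Fintype B] (l l' : List (Matrix B B ℂ)) (v : B → ℂ) :
    applyAll (l ++ l') v = applyAll l' (applyAll l v) := by
  simp [applyAll]

theorem applyAll_cons {B : Type} [Fintype B] (A : Matrix B B ℂ) (l : List (Matrix B B ℂ))
    (v : B → ℂ) : applyAll (A :: l) v = applyAll l (A *ᵥ v) := rfl

theorem applyAll_nil {B : Type} [Fintype B] (v : B → ℂ) : applyAll [] v = v := rfl

/-- The content of `adv`. -/
def advPart (y : CompQubit n → Bool) : Fin n → Bool := fun i => y (CompQubit.adv i)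

/-- The content of `aux`. -/
def auxPart (y : CompQubit n → Bool) : Fin n → Bool := fun i => y (CompQubit.aux i)

/-- A gate on `aux` acts on one tensor factor; `f` collects the dependence on `out` and `adv`, which
passes through. -/
theorem gate_aux_mulVec (g : Gate (Fin n)) (f : Bool → (Fin n → Bool) → ℂ)
    (χ : (Fin n → Bool) → ℂ) :
    (g.map (auxEmb n)).toMatrix *ᵥ (fun y => f (y CompQubit.out) (advPart y) * χ (auxPart y)) =
      fun y => f (y CompQubit.out) (advPart y) * (g.toMatrix *ᵥ χ) (auxPart y) := by
  ext y
  rw [Gate.toMatrix_map, Gate.toMatrix_eq, liftOp_mulVec, liftOp_mulVec, Finset.mul_sum]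
  refine Finset.sum_congr rfl fun u _ => ?_
  set w := g.wires.trans (auxEmb n) with hw
  have h1 : ∀ i, (∀ j, i ≠ CompQubit.aux j) → Function.extend w u y i = y i := by
    intro i hi
    refine extend_not_mem _ _ _ ?_
    rintro ⟨a, rfl⟩
    exact hi _ rfl
  have h2 : auxPart (Function.extend w u y) = Function.extend g.wires u (auxPart y) := by
    ext i
    by_cases hi : i ∈ Set.range g.wires
    · obtain ⟨a, rfl⟩ := hi
      rw [g.wires.injective.extend_apply]
      exact w.injective.extend_apply _ _ a
    · rw [extend_not_mem _ _ _ hi]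
      refine extend_not_mem _ _ _ ?_
      rintro ⟨a, ha⟩
      exact hi ⟨a, Sum.inr.inj (Sum.inr.inj ha)⟩
  have h3 : advPart (Function.extend w u y) = advPart y := by
    ext i
    exact h1 _ (by simp)
  rw [h1 CompQubit.out (by simp), h2, h3]
  change (g.op : Matrix (Fin g.arity → Bool) (Fin g.arity → Bool) ℂ) (auxPart y ∘ g.wires) u * _ = _
  ring

theorem applyAll_aux (C : List (Gate (Fin n))) (f : Bool → (Fin n → Bool) → ℂ)
    (χ : (Fin n → Bool) → ℂ) :
    applyAll (C.map fun g => (g.map (auxEmb n)).toMatrix)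
        (fun y => f (y CompQubit.out) (advPart y) * χ (auxPart y)) =
      fun y => f (y CompQubit.out) (advPart y) * applyAll (C.map Gate.toMatrix) χ (auxPart y) := by
  induction C generalizing χ with
  | nil => rfl
  | cons g C ih => rw [List.map_cons, List.map_cons, applyAll_cons, applyAll_cons,
      gate_aux_mulVec, ih]

/-- Permutation operators act by pullback, which reverses composition: applying the head first to
the vector means applying it last to the argument, hence `foldr`. -/
theorem applyAll_cswap (l : List (Fin n)) (v : (CompQubit n → Bool) → ℂ)
    (x : CompQubit n → Bool) :
    applyAll (l.map cswap) v x = v (l.foldr condSwap x) := by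
  induction l generalizing v with
  | nil => rfl
  | cons i l ih =>
    rw [List.map_cons, applyAll_cons, ih,
      involution_mulVec (condSwap_involutive i) (cswap_apply i), List.foldr_cons]

theorem foldr_condSwap (l : List (Fin n)) (hl : l.Nodup) (x : CompQubit n → Bool) :
    (l.foldr condSwap x) CompQubit.out = x CompQubit.out ∧
    ∀ i, (l.foldr condSwap x) (CompQubit.adv i) =
        (if x CompQubit.out ∧ i ∈ l then x (CompQubit.aux i) else x (CompQubit.adv i)) ∧
      (l.foldr condSwap x) (CompQubit.aux i) =
        (if x CompQubit.out ∧ i ∈ l then x (CompQubit.adv i) else x (CompQubit.aux i)) := by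
  induction l with
  | nil => simp
  | cons j l ih =>
    obtain ⟨hj, hl⟩ := List.nodup_cons.1 hl
    obtain ⟨h1, h2⟩ := ih hl
    rw [List.foldr_cons, condSwap_out]
    refine ⟨h1, fun i => ?_⟩
    rw [condSwap, h1]
    by_cases hx : x CompQubit.out = true
    · by_cases hij : i = j
      · subst hij
        simp [hx, h2, hj]
      · have e1 : Equiv.swap (CompQubit.adv j) (CompQubit.aux j) (CompQubit.adv i) =
            CompQubit.adv i := Equiv.swap_apply_of_ne_of_ne (by simpa using hij) (by simp)
        have e2 : Equiv.swap (CompQubit.adv j) (CompQubit.aux j) (CompQubit.aux i) =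
            CompQubit.aux i := Equiv.swap_apply_of_ne_of_ne (by simp) (by simpa using hij)
        simp only [hx, if_true, Function.comp, e1, e2, h2, List.mem_cons, hij, false_or, true_and,
          and_self]
    · simp [hx, h2]

theorem inputState_eq (ψ : (Fin n → Bool) → ℂ) :
    inputState ψ = fun y => (if y CompQubit.out then 0 else ψ (advPart y)) *
      (Pi.single (fun _ => false) 1 : (Fin n → Bool) → ℂ) (auxPart y) := by
  ext y
  have h : y = compInput (fun i => y (CompQubit.adv i)) ↔
      y CompQubit.out = false ∧ auxPart y = fun _ => false := by
    constructor
    · intro h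
      exact ⟨by rw [h]; rfl, by ext i; rw [h]; rfl⟩
    · rintro ⟨h1, h2⟩
      ext (u | i | i)
      · exact h1
      · rfl
      · exact congrFun h2 i
  simp only [inputState, h, Pi.single_apply]
  cases y CompQubit.out
  · simp
    rfl
  · simp

/-- The final NOT moves the antisymmetric branch of the swap test to `out = 0`. The two Hadamards
contribute the factor `1/2`, and the controlled swaps together exchange `adv` and `aux` in the
branch `out = 1`. -/
theorem swapTest_amplitude (C : List (Gate (Fin n))) (ψ : (Fin n → Bool) → ℂ)
    (y : CompQubit n → Bool) (hy : y CompQubit.out = false) :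
    applyAll (comparisonGates C) (inputState ψ) y =
      (ψ (advPart y) * circuitState C (auxPart y) -
        circuitState C (advPart y) * ψ (auxPart y)) / 2 := by
  have hs := inv_sqrt_two_mul_self
  rw [comparisonGates, applyAll_append, applyAll_append, applyAll_append, inputState_eq,
    applyAll_aux C (fun o a => if o then 0 else ψ a)]
  change applyAll [hadamardOut n, notOut n] (applyAll (List.ofFn fun i => cswap i)
    (applyAll [hadamardOut n] fun y => (if y CompQubit.out then 0 else ψ (advPart y)) *
      circuitState C (auxPart y))) y = _
  have hl : (List.ofFn fun i : Fin n => cswap i) = (List.finRange n).map cswap :=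
    List.ofFn_eq_map
  rw [hl, applyAll_cons, applyAll_cons, applyAll_nil, applyAll_cons, applyAll_nil,
    involution_mulVec flipOut_involutive notOut_apply, hadamardOut_mulVec, applyAll_cswap,
    applyAll_cswap]
  set y0 := Function.update (flipOut y) CompQubit.out false
  set y1 := Function.update (flipOut y) CompQubit.out true
  obtain ⟨a1, a2⟩ := foldr_condSwap (List.finRange n) (List.nodup_finRange n) y0
  obtain ⟨b1, b2⟩ := foldr_condSwap (List.finRange n) (List.nodup_finRange n) y1
  set z0 := (List.finRange n).foldr condSwap y0
  set z1 := (List.finRange n).foldr condSwap y1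
  have ha : ∀ o, advPart (Function.update z0 CompQubit.out o) = advPart y ∧
      auxPart (Function.update z0 CompQubit.out o) = auxPart y := by
    intro o
    constructor <;> ext i <;> simp [advPart, auxPart, a2, y0, flipOut]
  have hb : ∀ o, advPart (Function.update z1 CompQubit.out o) = auxPart y ∧
      auxPart (Function.update z1 CompQubit.out o) = advPart y := by
    intro o
    constructor <;> ext i <;> simp [advPart, auxPart, b2, y1, flipOut]
  rw [hadamardOut_mulVec, hadamardOut_mulVec]
  simp only [ha, hb, a1, b1]
  simp [y0, y1, flipOut, hy]
  linear_combination (ψ (advPart y) * circuitState C (auxPart y) -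
        circuitState C (advPart y) * ψ (auxPart y)) * hs

end SwapTest

end QVerifier

end

noncomputable section

namespace QVerifier

/-! ### The clock register -/

section Clock

variable {n T : ℕ}

theorem unary_injective {m j j' : ℕ} (hj : j ≤ m) (hj' : j' ≤ m) (h : unary m j = unary m j') :
    j = j' := by
  by_contra hne
  rcases Nat.lt_or_gt_of_ne hne with hlt | hlt
  · have := congrFun h ⟨j, by omega⟩
    simp [unary, hlt] at this
  · have := congrFun h ⟨j', by omega⟩
    simp [unary, hlt] at this

/-- The content of the clock. -/
def clockPart (z : MsgQubit n T → Bool) : Fin (n + T + 3) → Bool := fun i => z (Sum.inl i)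

/-- The content of the qubits of the comparison circuit. -/
def dataPart (z : MsgQubit n T → Bool) : CompQubit n → Bool := fun i => z (Sum.inr i)

/-- The basis state with clock value `j` and content `d` of the other registers. -/
def timeState (T j : ℕ) (d : CompQubit n → Bool) : MsgQubit n T → Bool :=
  Sum.elim (unary (n + T + 3) j) d

theorem sum_msg {M : Type*} [AddCommMonoid M] (F : (MsgQubit n T → Bool) → M) :
    ∑ z, F z = ∑ c : Fin (n + T + 3) → Bool, ∑ d : CompQubit n → Bool, F (Sum.elim c d) := by
  rw [← (Equiv.sumArrowEquivProdArrow _ _ _).symm.sum_comp, Fintype.sum_prod_type]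
  rfl

theorem sum_clock_eq {M : Type*} [AddCommMonoid M] (F : (MsgQubit n T → Bool) → M) (j : ℕ) :
    ∑ z : MsgQubit n T → Bool, (if clockPart z = unary (n + T + 3) j then F z else 0) =
      ∑ d, F (timeState T j d) := by
  rw [sum_msg, Finset.sum_eq_single (unary (n + T + 3) j)]
  · exact Finset.sum_congr rfl fun d _ => if_pos rfl
  · intro c _ hc
    exact Finset.sum_eq_zero fun d _ => if_neg hc
  · simp

theorem sum_legal_le_one (z : MsgQubit n T → Bool) :
    ∑ j ∈ Finset.range (n + T + 3 + 1),
      (if clockPart z = unary (n + T + 3) j then (1 : ℝ) else 0) ≤ 1 := by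
  rw [Finset.sum_boole]
  norm_cast
  refine Finset.card_le_one.2 fun a ha b hb => ?_
  simp only [Finset.mem_filter, Finset.mem_range] at ha hb
  exact unary_injective (by omega) (by omega) (ha.2.symm.trans hb.2)

/-- All clock qubits but the `j`-th have the value that they have at the times `j` and `j + 1`. -/
def NearTime (j : Fin (n + T + 3)) (z : MsgQubit n T → Bool) : Prop :=
  ∀ i, i ≠ j → z (Sum.inl i) = unary (n + T + 3) j i

instance (j : Fin (n + T + 3)) (z : MsgQubit n T → Bool) : Decidable (NearTime j z) := by
  unfold NearTime; infer_instance

theorem unary_update (m : ℕ) (j : Fin m) (o : Bool) :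
    Function.update (unary m j) j o = unary m (j + o.toNat) := by
  ext i
  by_cases h : i = j
  · subst h
    cases o <;> simp [unary]
  · rw [Function.update_of_ne h]
    have : i.val ≠ j.val := fun h' => h (Fin.ext h')
    cases o
    · rfl
    · simp only [unary, Bool.toNat_true, decide_eq_decide]
      omega

/-- The clock values `j` and `j + 1` differ only in the clock qubit of index `j`, so that one free
bit selects between them. -/
theorem sum_nearTime {M : Type*} [AddCommMonoid M] (F : (MsgQubit n T → Bool) → M)
    (j : Fin (n + T + 3)) :
    ∑ z, (if NearTime j z then F z else 0) =
      ∑ o : Bool, ∑ d, F (timeState T (j + o.toNat) d) := by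
  rw [sum_msg]
  have h : ∀ c : Fin (n + T + 3) → Bool, ∑ d, (if NearTime j (Sum.elim c d : MsgQubit n T → Bool)
      then F (Sum.elim c d) else 0) =
      if ∀ i, i ≠ j → c i = unary (n + T + 3) j i then ∑ d, F (Sum.elim c d) else 0 := by
    intro c
    by_cases hc : ∀ i, i ≠ j → c i = unary (n + T + 3) j i
    · rw [if_pos hc]
      exact Finset.sum_congr rfl fun d _ => if_pos hc
    · rw [if_neg hc]
      exact Finset.sum_eq_zero fun d _ => if_neg hc
  simp_rw [h]
  rw [← Finset.sum_filter]
  symm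
  refine Finset.sum_bij' (fun o _ => unary (n + T + 3) (j + o.toNat)) (fun c _ => c j)
    ?_ ?_ ?_ ?_ ?_
  · intro o _
    simp only [Finset.mem_filter, Finset.mem_univ, true_and]
    intro i hi
    rw [← unary_update, Function.update_of_ne hi]
  · simp
  · intro o _
    rw [← unary_update, Function.update_self]
  · intro c hc
    simp only [Finset.mem_filter, Finset.mem_univ, true_and] at hc
    rw [← unary_update]
    ext i
    by_cases hi : i = j
    · subst hi; simp
    · rw [Function.update_of_ne hi, hc i hi]
  · intro o _
    rfl

theorem timeState_apply_clock (j : Fin (n + T + 3)) (o : Bool) (d : CompQubit n → Bool) :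
    timeState T (j + o.toNat) d (Sum.inl j) = o := by
  simp only [timeState, Sum.elim_inl, ← unary_update, Function.update_self]

end Clock

/-! ### The measurement coins and the energy statistic -/

section Statistic

variable {n T : ℕ}

abbrev EnergyCoin (n T : ℕ) : Type := Option (Fin (n + T + 3) × (MsgQubit n T → PauliBasis))

instance : Fintype (EnergyCoin n T) := instFintypeOption

/-- In the test of the `j`-th gate the clock qubits except the `j`-th are measured in the
`Z` basis, the other qubits in a uniformly random basis. -/
def basisWeight (j : Fin (n + T + 3)) : MsgQubit n T → PauliBasis → ℝ
  | .inl i, p => if i = j then 1 / 3 else if p = .Z then 1 else 0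
  | .inr _, _ => 1 / 3

/-- With probability `1/2` all qubits are measured in the `Z` basis, otherwise the propagation
along a uniformly random gate is tested. -/
def coinWeight : EnergyCoin n T → ℝ
  | none => 1 / 2
  | some (j, β) => 1 / (2 * (n + T + 3 : ℕ)) * ∏ i, basisWeight j i (β i)

def coinBasis : EnergyCoin n T → MsgQubit n T → PauliBasis
  | none => fun _ => .Z
  | some (_, β) => β

theorem basisWeight_nonneg (j : Fin (n + T + 3)) (i : MsgQubit n T) (p : PauliBasis) :
    0 ≤ basisWeight j i p := by
  cases i <;> simp only [basisWeight]
  · split_ifs <;> norm_num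
  · norm_num

theorem sum_basisWeight (j : Fin (n + T + 3)) (i : MsgQubit n T) :
    ∑ p, basisWeight j i p = 1 := by
  cases i <;> simp only [basisWeight]
  · split_ifs <;> simp [card_pauliBasis]
  · simp [card_pauliBasis]

theorem coinWeight_nonneg (c : EnergyCoin n T) : 0 ≤ coinWeight c := by
  rcases c with _ | ⟨j, β⟩
  · norm_num [coinWeight]
  · exact mul_nonneg (by positivity) (Finset.prod_nonneg fun i _ => basisWeight_nonneg j i _)

theorem sum_coinWeight : ∑ c : EnergyCoin n T, coinWeight c = 1 := by
  have h : ∀ j : Fin (n + T + 3), ∑ β : MsgQubit n T → PauliBasis, ∏ i, basisWeight j i (β i) = 1 := by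
    intro j
    rw [← Fintype.piFinset_univ, ← Finset.prod_univ_sum]
    simp [sum_basisWeight]
  rw [Fintype.sum_option, Fintype.sum_prod_type]
  simp only [coinWeight, ← Finset.mul_sum, h]
  simp
  field_simp
  norm_num

variable (G : Fin (n + T + 3) → Matrix (CompQubit n → Bool) (CompQubit n → Bool) ℂ)
  (W : Fin (n + T + 3) → Finset (CompQubit n))

/-- The penalty for an outcome in the `Z` basis. -/
def zPenalty (z : MsgQubit n T → Bool) : ℝ :=
  (1 - ∑ j ∈ Finset.range (n + T + 3 + 1),
      if clockPart z = unary (n + T + 3) j then 1 else 0) +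
    (if clockPart z = unary (n + T + 3) 0 then
      (if dataPart z = compInput (advPart (dataPart z)) then 0 else 1) else 0) +
    (if clockPart z = unary (n + T + 3) (n + T + 3) then
      (if dataPart z CompQubit.out then 0 else ((n + T + 3 : ℕ) + 1 : ℝ)⁻¹) else 0)

/-- The estimate of the propagation energy of the `j`-th gate. -/
def propEst (j : Fin (n + T + 3)) (β : MsgQubit n T → PauliBasis) (b : MsgQubit n T → Bool) : ℝ :=
  if NearTime j b then 1 / 2 - (3 * shadowWeight (β (Sum.inl j)) (b (Sum.inl j)) false true *
    localEst (W j) (G j) (fun i => β (Sum.inr i)) (dataPart b)).re else 0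

/-- The statistic that the verifier averages. -/
def energyStat : EnergyCoin n T × (MsgQubit n T → Bool) → ℝ
  | (none, b) => 2 * zPenalty b
  | (some (j, β), b) => 2 * (n + T + 3 : ℕ) * propEst G W j β b

/-- The law of the record of one round. -/
def roundLaw (ρ : Matrix (MsgQubit n T → Bool) (MsgQubit n T → Bool) ℂ)
    (ω : EnergyCoin n T × (MsgQubit n T → Bool)) : ℝ :=
  coinWeight ω.1 * born ρ (coinBasis ω.1) ω.2

/-- The probability of the clock value `j`. -/
def clockWeight (ρ : Matrix (MsgQubit n T → Bool) (MsgQubit n T → Bool) ℂ) (j : ℕ) : ℝ :=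
  ∑ d, (ρ (timeState T j d) (timeState T j d)).re

/-- The energy of `ρ`, without the `Z` penalties, of the `j`-th gate. -/
def propEnergy (ρ : Matrix (MsgQubit n T → Bool) (MsgQubit n T → Bool) ℂ)
    (j : Fin (n + T + 3)) : ℝ :=
  (clockWeight ρ j + clockWeight ρ (j + 1)) / 2 -
    (∑ d, ∑ d', ρ (timeState T j d) (timeState T (j + 1) d') * G j d' d).re

/-- The energy of `ρ`. -/
def energy (ρ : Matrix (MsgQubit n T → Bool) (MsgQubit n T → Bool) ℂ) : ℝ :=
  (1 - ∑ j ∈ Finset.range (n + T + 3 + 1), clockWeight ρ j) +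
    (∑ d : CompQubit n → Bool, if d = compInput (advPart d) then 0 else
      (ρ (timeState T 0 d) (timeState T 0 d)).re) +
    ((n + T + 3 : ℕ) + 1 : ℝ)⁻¹ * (∑ d : CompQubit n → Bool, if d CompQubit.out then 0 else
      (ρ (timeState T (n + T + 3) d) (timeState T (n + T + 3) d)).re) +
    ∑ j, propEnergy G ρ j

variable {ρ : Matrix (MsgQubit n T → Bool) (MsgQubit n T → Bool) ℂ}

theorem sum_round (f : EnergyCoin n T × (MsgQubit n T → Bool) → ℝ) :
    ∑ ω, roundLaw ρ ω * f ω = 1 / 2 * ∑ b, (ρ b b).re * f (none, b) +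
      1 / (2 * (n + T + 3 : ℕ)) * ∑ j, ∑ β : MsgQubit n T → PauliBasis, ∑ b,
        (∏ i, basisWeight j i (β i)) * born ρ β b * f (some (j, β), b) := by
  rw [Fintype.sum_prod_type, Fintype.sum_option, Fintype.sum_prod_type]
  simp only [roundLaw, coinWeight, coinBasis, born_Z, Finset.mul_sum]
  refine congrArg₂ (· + ·) ?_ ?_
  · exact Finset.sum_congr rfl fun b _ => by ring
  · exact Finset.sum_congr rfl fun j _ => Finset.sum_congr rfl fun β _ =>
      Finset.sum_congr rfl fun b _ => by ring

theorem roundLaw_nonneg (hρ : IsDensity ρ) (ω : EnergyCoin n T × (MsgQubit n T → Bool)) :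
    0 ≤ roundLaw ρ ω :=
  mul_nonneg (coinWeight_nonneg _) (born_nonneg hρ.1 _ _)

theorem sum_roundLaw (hρ : IsDensity ρ) : ∑ ω, roundLaw ρ ω = 1 := by
  rw [Fintype.sum_prod_type]
  simp only [roundLaw, ← Finset.mul_sum, sum_born hρ.1.isHermitian, hρ.2]
  simpa using sum_coinWeight

theorem sum_third_vec (x y : Bool) :
    ∑ p : PauliBasis, ∑ c, (1 / 3 : ℂ) * 1 * (star (p.vec c x) * p.vec c y) =
      if x = y then 1 else 0 := by
  simp only [mul_one, ← Finset.mul_sum, sum_vec]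
  simp [card_pauliBasis]

theorem sum_third_shadowWeight (a a' x y : Bool) :
    ∑ p : PauliBasis, ∑ c, (1 / 3 : ℂ) * (3 * shadowWeight p c a a') *
      (star (p.vec c x) * p.vec c y) = if x = a ∧ y = a' then 1 else 0 := by
  rw [← sum_shadowWeight]
  exact Finset.sum_congr rfl fun p _ => Finset.sum_congr rfl fun c _ => by ring

/-- The expectation of a product statistic in the test of the `j`-th gate. -/
theorem sum_nearTime_mul_born (hρ : ρ.IsHermitian) (j : Fin (n + T + 3))
    (h : PauliBasis → Bool → ℂ) (k : CompQubit n → PauliBasis → Bool → ℂ) :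
    ∑ β : MsgQubit n T → PauliBasis, ∑ b : MsgQubit n T → Bool,
      ((∏ i, basisWeight j i (β i) : ℝ) : ℂ) * (born ρ β b : ℂ) *
        (if NearTime j b then h (β (Sum.inl j)) (b (Sum.inl j)) *
          ∏ i, k i (β (Sum.inr i)) (b (Sum.inr i)) else 0) =
    ∑ o : Bool, ∑ d, ∑ o' : Bool, ∑ d',
      ρ (timeState T (j + o.toNat) d) (timeState T (j + o'.toNat) d') *
        ((∑ p, ∑ c, 1 / 3 * h p c * (star (p.vec c o) * p.vec c o')) *
          ∏ i, ∑ p, ∑ c, 1 / 3 * k i p c * (star (p.vec c (d i)) * p.vec c (d' i))) := by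
  -- Basis weights and the condition `NearTime` are absorbed into one product over qubits: a clock
  -- qubit other than `j` must be measured in `Z` with its prescribed outcome.
  let f : MsgQubit n T → PauliBasis → Bool → ℂ := Sum.elim
    (fun i p c => if i = j then 1 / 3 * h p c else
      (if p = .Z then 1 else 0) * (if c = unary (n + T + 3) j i then 1 else 0))
    (fun i p c => 1 / 3 * k i p c)
  have hf : ∀ (β : MsgQubit n T → PauliBasis) (b : MsgQubit n T → Bool),
      ((∏ i, basisWeight j i (β i) : ℝ) : ℂ) * (born ρ β b : ℂ) *
        (if NearTime j b then h (β (Sum.inl j)) (b (Sum.inl j)) *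
          ∏ i, k i (β (Sum.inr i)) (b (Sum.inr i)) else 0) =
      (∏ i, f i (β i) (b i)) * (born ρ β b : ℂ) := by
    intro β b
    have hnear : (if NearTime j b then (1 : ℂ) else 0) =
        ∏ i : Fin (n + T + 3), if i = j then 1 else
          if b (Sum.inl i) = unary (n + T + 3) j i then 1 else 0 := by
      have : ∀ i : Fin (n + T + 3), (if i = j then (1 : ℂ) else
          if b (Sum.inl i) = unary (n + T + 3) j i then 1 else 0) =
          if i ≠ j → b (Sum.inl i) = unary (n + T + 3) j i then 1 else 0 := by
        intro i
        by_cases hi : i = j <;> simp [hi]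
      simp_rw [this, Fintype.prod_ite_zero, Finset.prod_const_one]
      rfl
    have hh : h (β (Sum.inl j)) (b (Sum.inl j)) =
        ∏ i : Fin (n + T + 3), if i = j then h (β (Sum.inl i)) (b (Sum.inl i)) else 1 := by
      simp
    rw [← mul_boole, hnear, hh, mul_right_comm]
    congr 1
    have hb : ((∏ i, basisWeight j i (β i) : ℝ) : ℂ) =
        (∏ i : Fin (n + T + 3), ((if i = j then 1 / 3 else
          if β (Sum.inl i) = .Z then 1 else 0 : ℝ) : ℂ)) * ∏ _i : CompQubit n, (1 / 3 : ℂ) := by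
      rw [Complex.ofReal_prod]
      refine (Fintype.prod_sum_type _).trans (congrArg₂ _ rfl ?_)
      simp [basisWeight]
    have hprod : ∏ i, f i (β i) (b i) = (∏ i : Fin (n + T + 3), f (Sum.inl i) (β (Sum.inl i))
        (b (Sum.inl i))) * ∏ i : CompQubit n, f (Sum.inr i) (β (Sum.inr i)) (b (Sum.inr i)) :=
      Fintype.prod_sum_type _
    rw [hb, hprod]
    simp only [f, Sum.elim_inl, Sum.elim_inr]
    rw [Finset.prod_mul_distrib (f := fun _ => (1 / 3 : ℂ))]
    have : ∀ a b c d e : ℂ, a * b * (c * d * e) = (a * c * e) * (b * d) := by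
      intros; ring
    rw [this, ← Finset.prod_mul_distrib, ← Finset.prod_mul_distrib]
    congr 1
    refine Finset.prod_congr rfl fun i _ => ?_
    by_cases hi : i = j
    · simp [hi]
    · simp only [if_neg hi]
      split_ifs <;> simp
  simp_rw [hf]
  rw [sum_prod_mul_born hρ]
  -- A `Z` outcome projects row and column alike, so only the blocks of `ρ` between the clock values
  -- `j` and `j + 1` remain.
  have hS : ∀ x y : MsgQubit n T → Bool, ρ x y * ∏ i, ∑ p, ∑ c, f i p c *
      (star (p.vec c (x i)) * p.vec c (y i)) = if NearTime j x then (if NearTime j y then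
        ρ x y * ((∑ p, ∑ c, 1 / 3 * h p c *
            (star (p.vec c (x (Sum.inl j))) * p.vec c (y (Sum.inl j)))) *
          ∏ i, ∑ p, ∑ c, 1 / 3 * k i p c *
            (star (p.vec c (x (Sum.inr i))) * p.vec c (y (Sum.inr i)))) else 0) else 0 := by
    intro x y
    rw [Fintype.prod_sum_type, ← ite_and, ← mul_boole, mul_assoc, mul_right_comm]
    congr 2
    have hi : ∀ i : Fin (n + T + 3), ∑ p, ∑ c, f (Sum.inl i) p c *
        (star (p.vec c (x (Sum.inl i))) * p.vec c (y (Sum.inl i))) =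
        (if i = j then ∑ p, ∑ c, 1 / 3 * h p c *
            (star (p.vec c (x (Sum.inl i))) * p.vec c (y (Sum.inl i))) else 1) *
          (if i ≠ j → x (Sum.inl i) = unary (n + T + 3) j i ∧
            y (Sum.inl i) = unary (n + T + 3) j i then 1 else 0) := by
      intro i
      by_cases hi : i = j
      · simp [f, hi]
      · rw [sum_pauliBasis]
        simp only [f, Sum.elim_inl, one_mul, ne_eq, hi, not_false_eq_true, if_true,
          forall_const, reduceCtorEq, if_false, zero_mul, Finset.sum_const_zero, zero_add]
        exact sum_vec_Z _ _ _
    simp_rw [hi]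
    rw [Finset.prod_mul_distrib, Fintype.prod_ite_zero, Finset.prod_const_one]
    congr 1
    · simp
    · have hiff : (∀ i, i ≠ j → x (Sum.inl i) = unary (n + T + 3) j i ∧
          y (Sum.inl i) = unary (n + T + 3) j i) ↔ NearTime j x ∧ NearTime j y :=
        ⟨fun h => ⟨fun i hi => (h i hi).1, fun i hi => (h i hi).2⟩,
          fun h i hi => ⟨h.1 i hi, h.2 i hi⟩⟩
      by_cases h : NearTime j x ∧ NearTime j y
      · rw [if_pos h, if_pos (hiff.2 h)]
      · rw [if_neg h, if_neg (mt hiff.1 h)]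
  simp_rw [hS]
  have hT : ∀ x : MsgQubit n T → Bool, (∑ y, if NearTime j x then (if NearTime j y then
        ρ x y * ((∑ p, ∑ c, 1 / 3 * h p c *
            (star (p.vec c (x (Sum.inl j))) * p.vec c (y (Sum.inl j)))) *
          ∏ i, ∑ p, ∑ c, 1 / 3 * k i p c *
            (star (p.vec c (x (Sum.inr i))) * p.vec c (y (Sum.inr i)))) else 0) else 0) =
      if NearTime j x then (∑ y, if NearTime j y then
        ρ x y * ((∑ p, ∑ c, 1 / 3 * h p c *
            (star (p.vec c (x (Sum.inl j))) * p.vec c (y (Sum.inl j)))) *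
          ∏ i, ∑ p, ∑ c, 1 / 3 * k i p c *
            (star (p.vec c (x (Sum.inr i))) * p.vec c (y (Sum.inr i)))) else 0) else 0 := by
    intro x
    split_ifs <;> simp
  simp_rw [hT, sum_nearTime, timeState_apply_clock]
  rfl

end Statistic

end QVerifier

end

noncomputable section

namespace QVerifier

/-! ### Mean and second moment of the energy statistic -/

section Moments

variable {n T : ℕ} {G : Fin (n + T + 3) → Matrix (CompQubit n → Bool) (CompQubit n → Bool) ℂ}
  {W : Fin (n + T + 3) → Finset (CompQubit n)}
  {ρ : Matrix (MsgQubit n T → Bool) (MsgQubit n T → Bool) ℂ}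

/-- With trivial weights, completeness of each basis leaves only diagonal entries, at the two clock
values compatible with `NearTime j`. -/
theorem sum_nearTime_born (hρ : ρ.IsHermitian) (j : Fin (n + T + 3)) :
    ∑ β : MsgQubit n T → PauliBasis, ∑ b : MsgQubit n T → Bool,
      (∏ i, basisWeight j i (β i)) * born ρ β b * (if NearTime j b then 1 else 0) =
    clockWeight ρ j + clockWeight ρ (j + 1) := by
  have h := sum_nearTime_mul_born hρ j (fun _ _ => 1) (fun _ _ _ => 1)
  simp only [sum_third_vec, Fintype.prod_ite_zero] at h
  simp only [Finset.prod_const_one, mul_one, ← funext_iff] at h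
  have h2 := congrArg Complex.re h
  simp only [Complex.re_sum] at h2
  convert h2 using 1
  · refine Finset.sum_congr rfl fun β _ => Finset.sum_congr rfl fun b _ => ?_
    rw [← Complex.ofReal_mul, Complex.re_ofReal_mul]
    split_ifs <;> simp
  · simp only [mul_boole, Fintype.sum_bool]
    simp [clockWeight, add_comm, apply_ite Complex.re]

/-- On clock qubit `j` the weight for `false true` selects the coherence between times `j` and `j +
1`. The data qubits give the matrix units of `localEst`, which `IsLocalOn.sum_eq` reassembles into
`G j`. -/
theorem sum_localEst_born (hρ : ρ.IsHermitian) (j : Fin (n + T + 3))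
    (hG : IsLocalOn (W j) (G j)) :
    ∑ β : MsgQubit n T → PauliBasis, ∑ b : MsgQubit n T → Bool,
      ((∏ i, basisWeight j i (β i) : ℝ) : ℂ) * (born ρ β b : ℂ) *
        (if NearTime j b then 3 * shadowWeight (β (Sum.inl j)) (b (Sum.inl j)) false true *
          localEst (W j) (G j) (fun i => β (Sum.inr i)) (dataPart b) else 0) =
    ∑ d, ∑ d', ρ (timeState T j d) (timeState T (j + 1) d') * G j d' d := by
  have h1 : ∀ (β : MsgQubit n T → PauliBasis) (b : MsgQubit n T → Bool),
      ((∏ i, basisWeight j i (β i) : ℝ) : ℂ) * (born ρ β b : ℂ) *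
        (if NearTime j b then 3 * shadowWeight (β (Sum.inl j)) (b (Sum.inl j)) false true *
          localEst (W j) (G j) (fun i => β (Sum.inr i)) (dataPart b) else 0) =
      ∑ a : W j → Bool, ∑ a' : W j → Bool, G j (extendZero (W j) a') (extendZero (W j) a) *
        (((∏ i, basisWeight j i (β i) : ℝ) : ℂ) * (born ρ β b : ℂ) *
        (if NearTime j b then 3 * shadowWeight (β (Sum.inl j)) (b (Sum.inl j)) false true *
          ∏ i, (if i ∈ W j then 3 * shadowWeight (β (Sum.inr i)) (b (Sum.inr i))
            (extendZero (W j) a i) (extendZero (W j) a' i) else 1) else 0)) := by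
    intro β b
    by_cases hb : NearTime j b
    · simp only [if_pos hb, localEst, Finset.mul_sum, dataPart]
      exact Finset.sum_congr rfl fun a _ => Finset.sum_congr rfl fun a' _ => by ring
    · simp [hb]
  have h2 : ∀ a a' : W j → Bool, ∑ β : MsgQubit n T → PauliBasis, ∑ b : MsgQubit n T → Bool,
      (((∏ i, basisWeight j i (β i) : ℝ) : ℂ) * (born ρ β b : ℂ) *
        (if NearTime j b then 3 * shadowWeight (β (Sum.inl j)) (b (Sum.inl j)) false true *
          ∏ i, (if i ∈ W j then 3 * shadowWeight (β (Sum.inr i)) (b (Sum.inr i))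
            (extendZero (W j) a i) (extendZero (W j) a' i) else 1) else 0)) =
      ∑ d, ∑ d', ρ (timeState T j d) (timeState T (j + 1) d') *
        ∏ i, (if i ∈ W j then
          (if d i = extendZero (W j) a i ∧ d' i = extendZero (W j) a' i then 1 else 0)
            else (if d i = d' i then 1 else 0)) := by
    intro a a'
    rw [sum_nearTime_mul_born hρ j (fun p c => 3 * shadowWeight p c false true)
      (fun i p c => if i ∈ W j then 3 * shadowWeight p c
            (extendZero (W j) a i) (extendZero (W j) a' i) else 1)]
    have h3 : ∀ (d d' : CompQubit n → Bool) (i : CompQubit n), ∑ p : PauliBasis, ∑ c, 1 / 3 *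
        (if i ∈ W j then 3 * shadowWeight p c (extendZero (W j) a i) (extendZero (W j) a' i)
          else 1) * (star (p.vec c (d i)) * p.vec c (d' i)) =
        (if i ∈ W j then
          (if d i = extendZero (W j) a i ∧ d' i = extendZero (W j) a' i then 1 else 0)
            else (if d i = d' i then 1 else 0)) := by
      intro d d' i
      by_cases hi : i ∈ W j
      · simp only [if_pos hi, sum_third_shadowWeight]
      · simp only [if_neg hi, sum_third_vec]
    simp_rw [h3, sum_third_shadowWeight]
    simp
  simp_rw [h1]
  have h4 : ∀ F : (MsgQubit n T → PauliBasis) → (MsgQubit n T → Bool) → (W j → Bool) →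
      (W j → Bool) → ℂ, ∑ β, ∑ b, ∑ a, ∑ a', F β b a a' = ∑ a, ∑ a', ∑ β, ∑ b, F β b a a' := by
    intro F
    rw [Finset.sum_congr rfl fun β _ => Finset.sum_comm, Finset.sum_comm]
    refine Finset.sum_congr rfl fun a _ => ?_
    rw [Finset.sum_congr rfl fun β _ => Finset.sum_comm, Finset.sum_comm]
  rw [h4]
  simp_rw [← Finset.mul_sum, h2]
  have h5 : ∀ F : (W j → Bool) → (W j → Bool) → (CompQubit n → Bool) → (CompQubit n → Bool) → ℂ,
      ∑ a, ∑ a', ∑ d, ∑ d', F a a' d d' = ∑ d, ∑ d', ∑ a, ∑ a', F a a' d d' := by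
    intro F
    rw [Finset.sum_congr rfl fun β _ => Finset.sum_comm, Finset.sum_comm]
    refine Finset.sum_congr rfl fun a _ => ?_
    rw [Finset.sum_congr rfl fun β _ => Finset.sum_comm, Finset.sum_comm]
  simp_rw [Finset.mul_sum]
  rw [h5]
  refine Finset.sum_congr rfl fun d _ => Finset.sum_congr rfl fun d' _ => ?_
  rw [← hG.sum_eq d d', Finset.mul_sum]
  simp_rw [Finset.mul_sum]
  exact Finset.sum_congr rfl fun a _ => Finset.sum_congr rfl fun a' _ => by ring

theorem sum_propEst (hρ : ρ.IsHermitian) (j : Fin (n + T + 3)) (hG : IsLocalOn (W j) (G j)) :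
    ∑ β : MsgQubit n T → PauliBasis, ∑ b : MsgQubit n T → Bool,
      (∏ i, basisWeight j i (β i)) * born ρ β b * propEst G W j β b = propEnergy G ρ j := by
  have h := congrArg Complex.re (sum_localEst_born hρ j hG)
  rw [propEnergy, ← h, ← sum_nearTime_born hρ j, Complex.re_sum, Finset.sum_div,
    ← Finset.sum_sub_distrib]
  refine Finset.sum_congr rfl fun β _ => ?_
  rw [Complex.re_sum, Finset.sum_div, ← Finset.sum_sub_distrib]
  refine Finset.sum_congr rfl fun b _ => ?_
  rw [← Complex.ofReal_mul, Complex.re_ofReal_mul, propEst]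
  split_ifs
  · ring
  · simp

theorem sum_zPenalty (hρ : IsDensity ρ) :
    ∑ b, (ρ b b).re * zPenalty b = energy G ρ - ∑ j, propEnergy G ρ j := by
  have htr : ∑ b, (ρ b b).re = 1 := by
    have := congrArg Complex.re hρ.2
    simpa [Matrix.trace] using this
  have h1 : ∑ b, (ρ b b).re * (1 - ∑ j ∈ Finset.range (n + T + 3 + 1),
      if clockPart b = unary (n + T + 3) j then 1 else 0) =
      1 - ∑ j ∈ Finset.range (n + T + 3 + 1), clockWeight ρ j := by
    simp_rw [mul_sub, Finset.mul_sum, mul_one, Finset.sum_sub_distrib, htr, mul_boole]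
    rw [Finset.sum_comm]
    simp_rw [sum_clock_eq (fun b => (ρ b b).re)]
    rfl
  have h2 := sum_clock_eq (fun b : MsgQubit n T → Bool => (ρ b b).re *
    (if dataPart b = compInput (advPart (dataPart b)) then 0 else 1)) 0
  have h3 := sum_clock_eq (fun b : MsgQubit n T → Bool => (ρ b b).re *
    (if dataPart b CompQubit.out then 0 else ((n + T + 3 : ℕ) + 1 : ℝ)⁻¹)) (n + T + 3)
  simp only [zPenalty, mul_add, Finset.sum_add_distrib, h1, mul_ite, mul_zero, mul_one] at h2 h3 ⊢
  rw [h2, h3, energy, add_sub_cancel_right, Finset.mul_sum]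
  refine congrArg₂ (· + ·) (congrArg₂ (· + ·) rfl rfl) (Finset.sum_congr rfl fun d _ => ?_)
  rw [mul_ite, mul_zero, mul_comm]
  rfl

/-- The factors `2` and `2 * (n + T + 3)` in `energyStat` cancel the probabilities of the `Z` round
and of testing a given gate. -/
theorem mean_energyStat (hρ : IsDensity ρ) (hG : ∀ j, IsLocalOn (W j) (G j)) :
    ∑ ω, roundLaw ρ ω * energyStat G W ω = energy G ρ := by
  rw [sum_round]
  have h1 : ∀ b : MsgQubit n T → Bool, (ρ b b).re * energyStat G W (none, b) =
      2 * ((ρ b b).re * zPenalty b) := fun b => by rw [energyStat]; ring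
  have h2 : ∀ (j : Fin (n + T + 3)) (β : MsgQubit n T → PauliBasis) (b : MsgQubit n T → Bool),
      (∏ i, basisWeight j i (β i)) * born ρ β b * energyStat G W (some (j, β), b) =
      (2 * (n + T + 3 : ℕ)) * ((∏ i, basisWeight j i (β i)) * born ρ β b * propEst G W j β b) :=
    fun j β b => by rw [energyStat]; ring
  simp_rw [h1, h2, ← Finset.mul_sum, sum_propEst hρ.1.isHermitian _ (hG _)]
  rw [sum_zPenalty (G := G) hρ]
  have : ((n + T + 3 : ℕ) : ℝ) ≠ 0 := by positivity
  field_simp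
  ring

theorem zPenalty_nonneg (b : MsgQubit n T → Bool) : 0 ≤ zPenalty b := by
  have h := sum_legal_le_one b
  unfold zPenalty
  refine add_nonneg (add_nonneg (by linarith) ?_) ?_
  · split_ifs <;> norm_num
  · split_ifs <;> first | exact le_rfl | positivity

theorem zPenalty_le (b : MsgQubit n T → Bool) : zPenalty b ≤ 3 := by
  have h : 0 ≤ ∑ j ∈ Finset.range (n + T + 3 + 1),
      (if clockPart b = unary (n + T + 3) j then (1 : ℝ) else 0) :=
    Finset.sum_nonneg fun _ _ => by split_ifs <;> norm_num
  have hinv : ((n + T + 3 : ℕ) + 1 : ℝ)⁻¹ ≤ 1 := inv_le_one_of_one_le₀ (by simp; positivity)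
  unfold zPenalty
  have h1 : (if clockPart b = unary (n + T + 3) 0 then
      (if dataPart b = compInput (advPart (dataPart b)) then (0 : ℝ) else 1) else 0) ≤ 1 := by
    split_ifs <;> norm_num
  have h2 : (if clockPart b = unary (n + T + 3) (n + T + 3) then
      (if dataPart b CompQubit.out then 0 else ((n + T + 3 : ℕ) + 1 : ℝ)⁻¹) else 0) ≤ 1 := by
    split_ifs <;> first | exact hinv | norm_num
  linarith

theorem abs_propEst_le {B : ℝ} {k : ℕ} (hB : B = 4 * 12 ^ k) (hW : ∀ j, (W j).card ≤ k)
    (hGU : ∀ j, G j ∈ Matrix.unitaryGroup (CompQubit n → Bool) ℂ) (j : Fin (n + T + 3))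
    (β : MsgQubit n T → PauliBasis) (b : MsgQubit n T → Bool) :
    |propEst G W j β b| ≤ B * if NearTime j b then 1 else 0 := by
  unfold propEst
  split_ifs
  · have h1 := norm_localEst_le (W := W j) (entry_norm_bound_of_unitary (hGU j))
      (fun i => β (Sum.inr i)) (dataPart b)
    have h2 := norm_shadowWeight_le (β (Sum.inl j)) (b (Sum.inl j)) false true
    have h3 : (12 : ℝ) ^ (W j).card ≤ 12 ^ k := pow_le_pow_right₀ (by norm_num) (hW j)
    have h4 : (1 : ℝ) ≤ 12 ^ k := one_le_pow₀ (by norm_num)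
    have h5 := Complex.abs_re_le_norm (3 * shadowWeight (β (Sum.inl j)) (b (Sum.inl j)) false true *
      localEst (W j) (G j) (fun i => β (Sum.inr i)) (dataPart b))
    rw [norm_mul, norm_mul] at h5
    have h6 : ‖(3 : ℂ)‖ * ‖shadowWeight (β (Sum.inl j)) (b (Sum.inl j)) false true‖ *
        ‖localEst (W j) (G j) (fun i => β (Sum.inr i)) (dataPart b)‖ ≤ 3 * 12 ^ k := by
      refine mul_le_mul ?_ (h1.trans h3) (norm_nonneg _) (by norm_num)
      norm_num
      linarith
    have h7 := abs_le.1 (h5.trans h6)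
    rw [hB, mul_one, abs_le]
    constructor <;> linarith [h7.1, h7.2]
  · simp

theorem abs_energyStat_le {B : ℝ} {k : ℕ} (hB : B = 4 * 12 ^ k) (hW : ∀ j, (W j).card ≤ k)
    (hGU : ∀ j, G j ∈ Matrix.unitaryGroup (CompQubit n → Bool) ℂ)
    (ω : EnergyCoin n T × (MsgQubit n T → Bool)) :
    |energyStat G W ω| ≤ 6 * ((n + T + 3 : ℕ) + 1) * B := by
  have hB1 : 1 ≤ B := by
    have h4 : (1 : ℝ) ≤ 12 ^ k := one_le_pow₀ (by norm_num)
    linarith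
  have hL : (0 : ℝ) ≤ (n + T + 3 : ℕ) := Nat.cast_nonneg _
  rcases ω with ⟨_ | ⟨j, β⟩, b⟩
  · have h1 := zPenalty_nonneg b
    have h2 := zPenalty_le b
    rw [energyStat, abs_of_nonneg (by linarith)]
    nlinarith
  · have h := abs_propEst_le hB hW hGU j β b
    rw [energyStat, abs_mul, abs_of_nonneg (by positivity)]
    have h2 : |propEst G W j β b| ≤ B := by
      refine h.trans ?_
      split_ifs <;> linarith
    nlinarith

theorem clockWeight_nonneg (hρ : IsDensity ρ) (j : ℕ) : 0 ≤ clockWeight ρ j :=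
  Finset.sum_nonneg fun _ _ => (Complex.nonneg_iff.1 hρ.1.diag_nonneg).1

theorem sum_clockWeight_le_one (hρ : IsDensity ρ) :
    ∑ j ∈ Finset.range (n + T + 3 + 1), clockWeight ρ j ≤ 1 := by
  have htr : ∑ b, (ρ b b).re = 1 := by
    have := congrArg Complex.re hρ.2
    simpa [Matrix.trace] using this
  rw [← htr]
  calc _ = ∑ b, (ρ b b).re * ∑ j ∈ Finset.range (n + T + 3 + 1),
        (if clockPart b = unary (n + T + 3) j then (1 : ℝ) else 0) := by
        simp_rw [Finset.mul_sum, mul_boole]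
        rw [Finset.sum_comm]
        simp_rw [sum_clock_eq (fun b => (ρ b b).re)]
        rfl
    _ ≤ ∑ b, (ρ b b).re := Finset.sum_le_sum fun b _ =>
        mul_le_of_le_one_right (Complex.nonneg_iff.1 hρ.1.diag_nonneg).1 (sum_legal_le_one b)

/-- The squared weight of order `(n + T + 3) ^ 2` meets the coin probability of order `1 / (n + T +
3)`, and the probabilities of being near time `j` add up to at most 2 over all gates. The result is
linear in the number of gates. -/
theorem secondMoment_energyStat_le (hρ : IsDensity ρ) {B : ℝ} {k : ℕ} (hB : B = 4 * 12 ^ k)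
    (hW : ∀ j, (W j).card ≤ k)
    (hGU : ∀ j, G j ∈ Matrix.unitaryGroup (CompQubit n → Bool) ℂ) :
    ∑ ω, roundLaw ρ ω * energyStat G W ω ^ 2 ≤ 22 * ((n + T + 3 : ℕ) + 1) * B ^ 2 := by
  have hB1 : 1 ≤ B := by
    have h4 : (1 : ℝ) ≤ 12 ^ k := one_le_pow₀ (by norm_num)
    linarith
  have hL : (0 : ℝ) < (n + T + 3 : ℕ) := by positivity
  have htr : ∑ b, (ρ b b).re = 1 := by
    have := congrArg Complex.re hρ.2
    simpa [Matrix.trace] using this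
  rw [sum_round]
  have h1 : ∑ b, (ρ b b).re * energyStat G W (none, b) ^ 2 ≤ 36 := by
    calc _ ≤ ∑ b, (ρ b b).re * 36 := by
          refine Finset.sum_le_sum fun b _ => mul_le_mul_of_nonneg_left ?_
            (Complex.nonneg_iff.1 hρ.1.diag_nonneg).1
          have h1 := zPenalty_nonneg b
          have h2 := zPenalty_le b
          rw [energyStat]
          nlinarith
      _ = 36 := by rw [← Finset.sum_mul, htr, one_mul]
  have h2 : ∀ j : Fin (n + T + 3), ∑ β : MsgQubit n T → PauliBasis, ∑ b,
      (∏ i, basisWeight j i (β i)) * born ρ β b * energyStat G W (some (j, β), b) ^ 2 ≤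
      (2 * (n + T + 3 : ℕ)) ^ 2 * B ^ 2 * (clockWeight ρ j + clockWeight ρ (j + 1)) := by
    intro j
    rw [← sum_nearTime_born hρ.1.isHermitian j, Finset.mul_sum]
    refine Finset.sum_le_sum fun β _ => ?_
    rw [Finset.mul_sum]
    refine Finset.sum_le_sum fun b _ => ?_
    have hnn : 0 ≤ (∏ i, basisWeight j i (β i)) * born ρ β b :=
      mul_nonneg (Finset.prod_nonneg fun i _ => basisWeight_nonneg j i _) (born_nonneg hρ.1 _ _)
    have h := abs_propEst_le hB hW hGU j β b
    have hsq : propEst G W j β b ^ 2 ≤ B ^ 2 * if NearTime j b then 1 else 0 := by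
      rw [← sq_abs]
      refine (pow_le_pow_left₀ (abs_nonneg _) h 2).trans (le_of_eq ?_)
      split_ifs <;> simp
    calc _ = (2 * (n + T + 3 : ℕ)) ^ 2 * (((∏ i, basisWeight j i (β i)) * born ρ β b) *
          propEst G W j β b ^ 2) := by rw [energyStat]; ring
      _ ≤ (2 * (n + T + 3 : ℕ)) ^ 2 * (((∏ i, basisWeight j i (β i)) * born ρ β b) *
          (B ^ 2 * if NearTime j b then 1 else 0)) := by gcongr
      _ = _ := by ring
  -- Each clock value belongs to at most two gates.
  have h3 : ∑ j : Fin (n + T + 3), (clockWeight ρ j + clockWeight ρ (j + 1)) ≤ 2 := by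
    have ha := sum_clockWeight_le_one hρ
    have hb := ha
    rw [Finset.sum_range_succ] at ha
    rw [Finset.sum_range_succ'] at hb
    rw [Finset.sum_add_distrib, Fin.sum_univ_eq_sum_range (fun j => clockWeight ρ j),
      Fin.sum_univ_eq_sum_range (fun j => clockWeight ρ (j + 1))]
    linarith [clockWeight_nonneg hρ 0, clockWeight_nonneg hρ (n + T + 3)]
  have h4 := Finset.sum_le_sum fun j (_ : j ∈ Finset.univ) => h2 j
  rw [← Finset.mul_sum] at h4
  have h5 := h4.trans (mul_le_mul_of_nonneg_left h3 (by positivity))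
  calc _ ≤ 1 / 2 * 36 + 1 / (2 * (n + T + 3 : ℕ)) * ((2 * (n + T + 3 : ℕ)) ^ 2 * B ^ 2 * 2) := by
        gcongr
    _ = 18 + 4 * (n + T + 3 : ℕ) * B ^ 2 := by field_simp; ring
    _ ≤ _ := by nlinarith

end Moments

end QVerifier

end

noncomputable section

namespace QVerifier

/-! ### Norms and the outcome of the swap test -/

section Norms

variable {X : Type} [Fintype X] [DecidableEq X]

theorem sum_norm_sq_unitary_mulVec {U : Matrix X X ℂ} (hU : U ∈ Matrix.unitaryGroup X ℂ)
    (v : X → ℂ) : ∑ x, ‖(U *ᵥ v) x‖ ^ 2 = ∑ x, ‖v x‖ ^ 2 := by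
  have h : ∀ w : X → ℂ, ((∑ x, ‖w x‖ ^ 2 : ℝ) : ℂ) = star w ⬝ᵥ w := by
    intro w
    simp [dotProduct, ← Complex.conj_mul']
  have h2 : star (U *ᵥ v) ⬝ᵥ (U *ᵥ v) = star v ⬝ᵥ v := by
    rw [Matrix.star_mulVec, ← Matrix.dotProduct_mulVec, Matrix.mulVec_mulVec,
      ← Matrix.star_eq_conjTranspose, Matrix.mem_unitaryGroup_iff'.1 hU, Matrix.one_mulVec]
  rw [← h, ← h] at h2
  exact_mod_cast h2

theorem sum_norm_sq_applyAll {l : List (Matrix X X ℂ)}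
    (hl : ∀ A ∈ l, A ∈ Matrix.unitaryGroup X ℂ) (v : X → ℂ) :
    ∑ x, ‖applyAll l v x‖ ^ 2 = ∑ x, ‖v x‖ ^ 2 := by
  induction l generalizing v with
  | nil => rfl
  | cons A l ih =>
    rw [applyAll_cons, ih (fun B hB => hl B (List.mem_cons_of_mem _ hB)),
      sum_norm_sq_unitary_mulVec (hl A List.mem_cons_self)]

end Norms

/-! ### The outcome of the swap test, and the Hellinger distance in terms of overlaps. -/

section SwapTestNorm

variable {n : ℕ}

theorem sum_circuitDist (C : List (Gate (Fin n))) : ∑ x, circuitDist C x = 1 := by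
  simp only [circuitDist, circuitState]
  rw [sum_norm_sq_applyAll]
  · simp [Pi.single_apply, apply_ite]
  · intro A hA
    obtain ⟨g, _, rfl⟩ := List.mem_map.1 hA
    exact liftOp_mem_unitaryGroup _ g.op.2

theorem sum_comp {M : Type*} [AddCommMonoid M] (F : Bool → (Fin n → Bool) → (Fin n → Bool) → M) :
    ∑ y : CompQubit n → Bool, F (y CompQubit.out) (advPart y) (auxPart y) =
      ∑ o, ∑ a, ∑ b, F o a b := by
  rw [← (Equiv.sumArrowEquivProdArrow _ _ _).symm.sum_comp, Fintype.sum_prod_type,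
    ← (Equiv.funUnique Unit Bool).symm.sum_comp]
  refine Finset.sum_congr rfl fun o _ => ?_
  rw [← (Equiv.sumArrowEquivProdArrow _ _ _).symm.sum_comp, Fintype.sum_prod_type]
  rfl

/-- Lagrange's identity: the norm of an antisymmetrised product measures the defect in
Cauchy–Schwarz. -/
theorem sum_norm_sq_antisymm {X : Type} [Fintype X] (ψ χ : X → ℂ) :
    ∑ a, ∑ b, ‖(ψ a * χ b - χ a * ψ b) / 2‖ ^ 2 =
      ((∑ a, ‖ψ a‖ ^ 2) * (∑ a, ‖χ a‖ ^ 2) - ‖∑ a, star (χ a) * ψ a‖ ^ 2) / 2 := by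
  have h : ∀ a b, ((‖(ψ a * χ b - χ a * ψ b) / 2‖ ^ 2 : ℝ) : ℂ) =
      ((star (ψ a) * ψ a) * (star (χ b) * χ b) + (star (χ a) * χ a) * (star (ψ b) * ψ b) -
        (star (ψ a) * χ a) * (star (χ b) * ψ b) - (star (χ a) * ψ a) * (star (ψ b) * χ b)) / 4 := by
    intro a b
    push_cast
    rw [← Complex.conj_mul', map_div₀, Complex.conj_ofNat]
    simp
    ring
  have hs : (((∑ a, ‖ψ a‖ ^ 2) * (∑ a, ‖χ a‖ ^ 2) - ‖∑ a, star (χ a) * ψ a‖ ^ 2 : ℝ) : ℂ) =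
      (∑ a, star (ψ a) * ψ a) * (∑ a, star (χ a) * χ a) -
        (∑ a, star (ψ a) * χ a) * (∑ a, star (χ a) * ψ a) := by
    push_cast
    simp_rw [← Complex.conj_mul']
    simp [map_sum, mul_comm]
  have : ((∑ a, ∑ b, ‖(ψ a * χ b - χ a * ψ b) / 2‖ ^ 2 : ℝ) : ℂ) =
      (((∑ a, ‖ψ a‖ ^ 2) * (∑ a, ‖χ a‖ ^ 2) - ‖∑ a, star (χ a) * ψ a‖ ^ 2 : ℝ) : ℂ) / 2 := by
    rw [hs, Complex.ofReal_sum]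
    simp_rw [Complex.ofReal_sum, h, ← Finset.sum_div, Finset.sum_sub_distrib,
      Finset.sum_add_distrib, ← Finset.mul_sum, ← Finset.sum_mul]
    ring
  exact_mod_cast this

/-- The probability that the comparison circuit leaves `out` at zero. -/
theorem swapTest_norm (C : List (Gate (Fin n))) (ψ : (Fin n → Bool) → ℂ) :
    ∑ y : CompQubit n → Bool, (if y CompQubit.out then 0 else
      ‖applyAll (comparisonGates C) (inputState ψ) y‖ ^ 2) =
      ((∑ a, ‖ψ a‖ ^ 2) - ‖∑ a, star (circuitState C a) * ψ a‖ ^ 2) / 2 := by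
  have h : ∀ y : CompQubit n → Bool, (if y CompQubit.out then 0 else
      ‖applyAll (comparisonGates C) (inputState ψ) y‖ ^ 2) =
      (fun (o : Bool) (a b : Fin n → Bool) => if o then (0 : ℝ) else
        ‖(ψ a * circuitState C b - circuitState C a * ψ b) / 2‖ ^ 2)
        (y CompQubit.out) (advPart y) (auxPart y) := by
    intro y
    by_cases hy : y CompQubit.out = true
    · simp [hy]
    · rw [if_neg hy, swapTest_amplitude C ψ y (by simpa using hy)]
      simp [hy]
  refine (Finset.sum_congr rfl fun y _ => h y).trans ((sum_comp fun (o : Bool)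
    (a b : Fin n → Bool) => if o then (0 : ℝ) else
      ‖(ψ a * circuitState C b - circuitState C a * ψ b) / 2‖ ^ 2).trans ?_)
  rw [Fintype.sum_bool]
  have h1 : ∑ a, ‖circuitState C a‖ ^ 2 = 1 := sum_circuitDist C
  have h2 := sum_norm_sq_antisymm ψ (circuitState C)
  rw [h1, mul_one] at h2
  simpa using h2

theorem hellinger_sq {B : Type} [Fintype B] {P Q : B → ℝ} (hP0 : ∀ x, 0 ≤ P x)
    (hQ0 : ∀ x, 0 ≤ Q x) (hP : ∑ x, P x = 1) (hQ : ∑ x, Q x = 1) :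
    hellinger P Q ^ 2 = 1 - ∑ x, √(P x) * √(Q x) := by
  rw [hellinger, mul_pow, Real.sq_sqrt (Finset.sum_nonneg fun _ _ => sq_nonneg _), div_pow,
    Real.sq_sqrt (by norm_num)]
  have : ∀ x, (√(P x) - √(Q x)) ^ 2 = P x + Q x - 2 * (√(P x) * √(Q x)) := by
    intro x
    rw [sub_sq, Real.sq_sqrt (hP0 x), Real.sq_sqrt (hQ0 x)]
    ring
  simp_rw [this]
  rw [Finset.sum_sub_distrib, Finset.sum_add_distrib, hP, hQ, ← Finset.mul_sum]
  ring

theorem hellinger_nonneg {B : Type} [Fintype B] (P Q : B → ℝ) : 0 ≤ hellinger P Q := by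
  unfold hellinger; positivity

/-- A large overlap of `χ` with an unnormalized ensemble `ψ` makes the two outcome distributions
close. -/
theorem hellinger_le_of_overlap {B I : Type} [Fintype B] [Fintype I] {χ : B → ℂ}
    (hχ : ∑ x, ‖χ x‖ ^ 2 = 1) {ψ : B → I → ℂ} {q κ : ℝ} (hq : q = ∑ x, ∑ i, ‖ψ x i‖ ^ 2)
    (hq0 : 0 < q) (h : (1 - κ) * q ≤ ∑ i, ‖∑ x, star (χ x) * ψ x i‖ ^ 2) :
    hellinger (fun x => ‖χ x‖ ^ 2) (fun x => (∑ i, ‖ψ x i‖ ^ 2) / q) ^ 2 ≤ κ := by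
  have hQ0 : ∀ x, 0 ≤ (∑ i, ‖ψ x i‖ ^ 2) / q := fun x =>
    div_nonneg (Finset.sum_nonneg fun _ _ => sq_nonneg _) hq0.le
  have hQ : ∑ x, (∑ i, ‖ψ x i‖ ^ 2) / q = 1 := by
    rw [← Finset.sum_div, ← hq, div_self hq0.ne']
  have hH := hellinger_sq (fun x => sq_nonneg ‖χ x‖) hQ0 hχ hQ
  set bc := ∑ x, √(‖χ x‖ ^ 2) * √((∑ i, ‖ψ x i‖ ^ 2) / q) with hbc
  have hbc0 : 0 ≤ bc := Finset.sum_nonneg fun _ _ => by positivity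
  have hbc1 : bc ≤ 1 := by
    have := sq_nonneg (hellinger (fun x => ‖χ x‖ ^ 2) (fun x => (∑ i, ‖ψ x i‖ ^ 2) / q))
    linarith
  -- Minkowski in the `ℓ²` space over the ensemble index: the vector-valued overlap is at most the
  -- sum of `‖χ x‖` times the norms of the `ψ x`, which is `bc * √q`.
  have hmink : ∑ i, ‖∑ x, star (χ x) * ψ x i‖ ^ 2 ≤ bc ^ 2 * q := by
    let e : B → EuclideanSpace ℂ I := fun x => WithLp.toLp 2 (ψ x)
    have h1 : ∑ i, ‖∑ x, star (χ x) * ψ x i‖ ^ 2 = ‖∑ x, star (χ x) • e x‖ ^ 2 := by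
      rw [EuclideanSpace.norm_sq_eq]
      simp [e]
    have h2 : ‖∑ x, star (χ x) • e x‖ ≤ bc * √q := by
      refine (norm_sum_le _ _).trans (le_of_eq ?_)
      rw [hbc, Finset.sum_mul]
      refine Finset.sum_congr rfl fun x _ => ?_
      rw [norm_smul, norm_star, Real.sqrt_sq (norm_nonneg _), mul_assoc,
        ← Real.sqrt_mul (hQ0 x), div_mul_cancel₀ _ hq0.ne', EuclideanSpace.norm_eq]
    rw [h1]
    refine (pow_le_pow_left₀ (norm_nonneg _) h2 2).trans (le_of_eq ?_)
    rw [mul_pow, Real.sq_sqrt hq0.le]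
  have h3 : 1 - κ ≤ bc ^ 2 := le_of_mul_le_mul_right (h.trans hmink) hq0
  rw [hH]
  -- Since `0 ≤ bc ≤ 1`, one has `1 - bc ≤ 1 - bc ^ 2 ≤ κ`.
  nlinarith

end SwapTestNorm

end QVerifier

end

noncomputable section

namespace QVerifier

attribute [local instance] Matrix.frobeniusNormedAddCommGroup

/-! ### The energy of a mixture of pure states -/

section Frobenius

variable {X I : Type} [Fintype X] [Fintype I]

theorem frobenius_sq (A : Matrix X I ℂ) : ‖A‖ ^ 2 = ∑ x, ∑ i, ‖A x i‖ ^ 2 := by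
  rw [Matrix.frobenius_norm_def, ← Real.sqrt_eq_rpow, Real.sq_sqrt]
  · simp
  · positivity

theorem frobenius_unitary_mul [DecidableEq X] {U : Matrix X X ℂ} (hU : U ∈ Matrix.unitaryGroup X ℂ)
    (A : Matrix X I ℂ) : ‖U * A‖ = ‖A‖ := by
  rw [← sq_eq_sq₀ (norm_nonneg _) (norm_nonneg _), frobenius_sq, frobenius_sq, Finset.sum_comm,
    Finset.sum_comm (γ := X)]
  exact Finset.sum_congr rfl fun i _ => sum_norm_sq_unitary_mulVec hU (fun x => A x i)

theorem frobenius_sub_sq (A B : Matrix X I ℂ) :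
    ‖A - B‖ ^ 2 = ‖A‖ ^ 2 + ‖B‖ ^ 2 - 2 * (∑ x, ∑ i, star (A x i) * B x i).re := by
  rw [frobenius_sq, frobenius_sq, frobenius_sq, Complex.re_sum, Finset.mul_sum,
    ← Finset.sum_add_distrib, ← Finset.sum_sub_distrib]
  refine Finset.sum_congr rfl fun x _ => ?_
  rw [Complex.re_sum, Finset.mul_sum, ← Finset.sum_add_distrib, ← Finset.sum_sub_distrib]
  refine Finset.sum_congr rfl fun i _ => ?_
  simp only [Matrix.sub_apply, ← Complex.normSq_eq_norm_sq, Complex.normSq_apply, Complex.sub_re,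
    Complex.sub_im, Complex.mul_re, Complex.star_def, Complex.conj_re, Complex.conj_im]
  ring

end Frobenius

section MixtureEnergy

variable {n T : ℕ} {I : Type}

/-- The components on legal inputs of the comparison circuit. -/
def inputProj (A : Matrix (CompQubit n → Bool) I ℂ) : Matrix (CompQubit n → Bool) I ℂ :=
  fun d i => if d = compInput (advPart d) then A d i else 0

/-- The components with `out` equal to zero. -/
def outProj (A : Matrix (CompQubit n → Bool) I ℂ) : Matrix (CompQubit n → Bool) I ℂ :=
  fun d i => if d CompQubit.out then 0 else A d i

theorem outProj_add (A B : Matrix (CompQubit n → Bool) I ℂ) :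
    outProj (A + B) = outProj A + outProj B := by
  ext d i
  simp only [outProj, Matrix.add_apply]
  split_ifs <;> simp

/-- The part of an ensemble of vectors that belongs to the clock value `j`. -/
def slice (Φ : Matrix (MsgQubit n T → Bool) I ℂ) (j : ℕ) : Matrix (CompQubit n → Bool) I ℂ :=
  fun d i => Φ (timeState T j d) i

variable [Fintype I]

theorem mixture_diag {X : Type} (Φ : Matrix X I ℂ) (x : X) :
    ((Φ * Φᴴ) x x).re = ∑ i, ‖Φ x i‖ ^ 2 := by
  simp [Matrix.mul_apply, Complex.mul_conj, Complex.normSq_eq_norm_sq,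
    -Complex.ofReal_pow]

theorem clockWeight_mixture (Φ : Matrix (MsgQubit n T → Bool) I ℂ) (j : ℕ) :
    clockWeight (Φ * Φᴴ) j = ‖slice Φ j‖ ^ 2 := by
  rw [frobenius_sq, clockWeight]
  exact Finset.sum_congr rfl fun d _ => mixture_diag _ _

/-- By unitarity of `G j` the two clock weights are the squared norms of the next slice and of the
propagated slice, and the coherence term is their inner product; together they complete a square. -/
theorem propEnergy_mixture
    {G : Fin (n + T + 3) → Matrix (CompQubit n → Bool) (CompQubit n → Bool) ℂ}
    (Φ : Matrix (MsgQubit n T → Bool) I ℂ) (j : Fin (n + T + 3))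
    (hG : G j ∈ Matrix.unitaryGroup (CompQubit n → Bool) ℂ) :
    propEnergy G (Φ * Φᴴ) j = ‖slice Φ (j + 1) - G j * slice Φ j‖ ^ 2 / 2 := by
  rw [propEnergy, clockWeight_mixture, clockWeight_mixture, frobenius_sub_sq,
    frobenius_unitary_mul hG]
  have : ∑ d, ∑ d', (Φ * Φᴴ) (timeState T j d) (timeState T (j + 1) d') * G j d' d =
      ∑ x, ∑ i, star (slice Φ (j + 1) x i) * (G j * slice Φ j) x i := by
    simp only [Matrix.mul_apply, Matrix.conjTranspose_apply, slice, Finset.sum_mul, Finset.mul_sum]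
    rw [Finset.sum_comm]
    refine Finset.sum_congr rfl fun d' _ => ?_
    rw [Finset.sum_comm]
    exact Finset.sum_congr rfl fun i _ => Finset.sum_congr rfl fun d _ => by ring
  rw [this]
  ring

theorem norm_outProj_sq (A : Matrix (CompQubit n → Bool) I ℂ) :
    ‖outProj A‖ ^ 2 = ∑ d, if d CompQubit.out then 0 else ∑ i, ‖A d i‖ ^ 2 := by
  rw [frobenius_sq]
  refine Finset.sum_congr rfl fun d _ => ?_
  simp only [outProj]
  split_ifs <;> simp

theorem norm_outProj_le (A : Matrix (CompQubit n → Bool) I ℂ) : ‖outProj A‖ ≤ ‖A‖ := by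
  rw [← sq_le_sq₀ (norm_nonneg _) (norm_nonneg _), norm_outProj_sq, frobenius_sq]
  refine Finset.sum_le_sum fun d _ => ?_
  split_ifs
  · positivity
  · exact le_rfl

/-- For a density matrix all four terms are nonnegative (the first by `sum_clockWeight_le_one`), so
a bound on the energy bounds each of them separately. -/
theorem energy_mixture
    {G : Fin (n + T + 3) → Matrix (CompQubit n → Bool) (CompQubit n → Bool) ℂ}
    (hG : ∀ j, G j ∈ Matrix.unitaryGroup (CompQubit n → Bool) ℂ)
    (Φ : Matrix (MsgQubit n T → Bool) I ℂ) :
    energy G (Φ * Φᴴ) = (1 - ∑ j ∈ Finset.range (n + T + 3 + 1), ‖slice Φ j‖ ^ 2) +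
      ‖slice Φ 0 - inputProj (slice Φ 0)‖ ^ 2 +
      ((n + T + 3 : ℕ) + 1 : ℝ)⁻¹ * ‖outProj (slice Φ (n + T + 3))‖ ^ 2 +
      ∑ j : Fin (n + T + 3), ‖slice Φ (j + 1) - G j * slice Φ j‖ ^ 2 / 2 := by
  rw [energy]
  simp only [clockWeight_mixture, propEnergy_mixture Φ _ (hG _), mixture_diag, norm_outProj_sq]
  congr 3
  rw [frobenius_sq]
  refine Finset.sum_congr rfl fun d _ => ?_
  simp only [inputProj, Matrix.sub_apply]
  split_ifs <;> simp [slice]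

end MixtureEnergy

/-! ### States of low energy -/

section LowEnergy

variable {n : ℕ} (C : List (Gate (Fin n)))

/-- The gates of the comparison circuit, indexed by time. -/
def gateAt (j : ℕ) : Matrix (CompQubit n → Bool) (CompQubit n → Bool) ℂ :=
  (comparisonGates C).getD j 1

theorem gateAt_mem (j : Fin (n + C.length + 3)) : gateAt C j ∈ comparisonGates C := by
  have hj : (j : ℕ) < (comparisonGates C).length := by
    rw [length_comparisonGates]; exact j.2
  rw [gateAt, List.getD_eq_getElem _ _ hj]
  exact List.getElem_mem hj

theorem comparisonGates_unitary {A : Matrix (CompQubit n → Bool) (CompQubit n → Bool) ℂ}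
    (hA : A ∈ comparisonGates C) : A ∈ Matrix.unitaryGroup (CompQubit n → Bool) ℂ :=
  -- Any bound on the arities serves here, since only the unitarity half of the conclusion is kept.
  (mem_comparisonGates (k := (C.map Gate.arity).sum)
    (fun g hg => List.single_le_sum (by simp) _ (List.mem_map_of_mem hg)) hA).1

theorem gateAt_unitary (j : ℕ) : gateAt C j ∈ Matrix.unitaryGroup (CompQubit n → Bool) ℂ := by
  by_cases hj : j < n + C.length + 3
  · exact comparisonGates_unitary C (gateAt_mem C ⟨j, hj⟩)
  -- Beyond the last gate the default is the identity, so `evolution` is unitary at every index.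
  · rw [gateAt, List.getD_eq_default _ _ (by rw [length_comparisonGates]; omega)]
    exact one_mem _

/-- The product of the first `j` gates. -/
def evolution : ℕ → Matrix (CompQubit n → Bool) (CompQubit n → Bool) ℂ
  | 0 => 1
  | j + 1 => gateAt C j * evolution j

theorem evolution_unitary (j : ℕ) :
    evolution C j ∈ Matrix.unitaryGroup (CompQubit n → Bool) ℂ := by
  induction j with
  | zero => exact one_mem _
  | succ j ih => exact mul_mem (gateAt_unitary C j) ih

theorem applyAll_take_succ {j : ℕ} (hj : j < n + C.length + 3)
    (v : (CompQubit n → Bool) → ℂ) : applyAll ((comparisonGates C).take (j + 1)) v =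
      gateAt C j *ᵥ applyAll ((comparisonGates C).take j) v := by
  have hj' : j < (comparisonGates C).length := by rwa [length_comparisonGates]
  rw [List.take_succ_eq_append_getElem hj', applyAll_append, gateAt,
    List.getD_eq_getElem _ _ hj']
  rfl

theorem evolution_mulVec {j : ℕ} (hj : j ≤ n + C.length + 3) (v : (CompQubit n → Bool) → ℂ) :
    evolution C j *ᵥ v = applyAll ((comparisonGates C).take j) v := by
  induction j with
  | zero => simp [evolution, applyAll]
  | succ j ih =>
    rw [applyAll_take_succ C (by omega), ← ih (by omega), evolution, Matrix.mulVec_mulVec]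

/-- A telescoping sum: unitary gates preserve the error accumulated so far, and each step adds only
its own defect. -/
theorem norm_sub_evolution_le {I : Type} [Fintype I]
    (v : ℕ → Matrix (CompQubit n → Bool) I ℂ) (j : ℕ) :
    ‖v j - evolution C j * v 0‖ ≤ ∑ i ∈ Finset.range j, ‖v (i + 1) - gateAt C i * v i‖ := by
  induction j with
  | zero => simp [evolution]
  | succ j ih =>
    rw [Finset.sum_range_succ]
    have h : v (j + 1) - evolution C (j + 1) * v 0 =
        gateAt C j * (v j - evolution C j * v 0) + (v (j + 1) - gateAt C j * v j) := by
      rw [evolution, Matrix.mul_sub, Matrix.mul_assoc]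
      abel
    rw [h]
    refine (norm_add_le _ _).trans ?_
    rw [frobenius_unitary_mul (gateAt_unitary C j)]
    linarith

theorem slice_inputProj_col {T : ℕ} {I : Type}
    (Φ : Matrix (MsgQubit n T → Bool) I ℂ) (i : I) :
    (fun d => inputProj (slice Φ 0) d i) =
      inputState (fun x => slice Φ 0 (compInput x) i) := by
  ext d
  by_cases h : d = compInput (advPart d)
  · exact (if_pos h).trans ((congrArg (fun z => slice Φ 0 z i) h).trans (if_pos h).symm)
  · exact (if_neg h).trans (if_neg h).symm

theorem sum_inputState_norm_sq (ψ : (Fin n → Bool) → ℂ) :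
    ∑ d, ‖inputState ψ d‖ ^ 2 = ∑ x, ‖ψ x‖ ^ 2 := by
  have h : ∀ d : CompQubit n → Bool, ‖inputState ψ d‖ ^ 2 = (fun (o : Bool)
      (a b : Fin n → Bool) => if o then 0 else if b = (fun _ => false) then ‖ψ a‖ ^ 2 else 0)
        (d CompQubit.out) (advPart d) (auxPart d) := by
    intro d
    rw [inputState_eq]
    simp only [Pi.single_apply]
    split_ifs <;> simp
  refine (Finset.sum_congr rfl fun y _ => h y).trans ((sum_comp fun (o : Bool)
    (a b : Fin n → Bool) => if o then (0 : ℝ) else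
      if b = (fun _ => false) then ‖ψ a‖ ^ 2 else 0).trans ?_)
  simp

theorem timeState_zero (T : ℕ) (d : CompQubit n → Bool) :
    timeState T 0 d = Sum.elim (fun _ => false) d := by
  have : unary (n + T + 3) 0 = fun _ => false := by ext; simp [unary]
  rw [timeState, this]

theorem advWeight_mixture {T : ℕ} {I : Type} [Fintype I]
    (Φ : Matrix (MsgQubit n T → Bool) I ℂ) (x : Fin n → Bool) :
    advWeight (Φ * Φᴴ) x = ∑ i, ‖slice Φ 0 (compInput x) i‖ ^ 2 := by
  rw [advWeight, mixture_diag]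
  simp only [slice, timeState_zero]

theorem advProb_mixture {T : ℕ} {I : Type} [Fintype I]
    (Φ : Matrix (MsgQubit n T → Bool) I ℂ) :
    advProb (Φ * Φᴴ) = ‖inputProj (slice Φ 0)‖ ^ 2 := by
  rw [frobenius_sq, Finset.sum_comm, advProb]
  simp only [advWeight_mixture]
  rw [Finset.sum_comm]
  refine Finset.sum_congr rfl fun i _ => ?_
  rw [← sum_inputState_norm_sq fun x => slice Φ 0 (compInput x) i, ← slice_inputProj_col]

/-- The numerical core of the soundness argument: `a`, `b`, `z`, `p` are the norms of the initial
part, its legal component, the illegal component, and the final rejected component. -/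
theorem low_energy_numeric {M η r a b z p e : ℝ} (hM : 1 ≤ M) (hη : 0 < η) (hη0 : η ≤ 1 / 100)
    (hr : 0 < r) (hrM : r ^ 2 * M = 1) (ha : 0 ≤ a) (he : 0 ≤ e)
    (hmass : 1 - 3 * (η ^ 2 / M ^ 2) ≤ M * (a + e) ^ 2)
    (he2 : e ^ 2 ≤ M * (6 * (η ^ 2 / M ^ 2))) (hz : z ^ 2 ≤ 3 * (η ^ 2 / M ^ 2))
    (hp : p ^ 2 ≤ M * (3 * (η ^ 2 / M ^ 2))) (hab : a ≤ b + z) :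
    0 < b ∧ p + e + z ≤ 14 * η * b := by
  have hM0 : 0 < M := by linarith
  have hrinv : r ^ 2 = 1 / M := by field_simp; exact hrM
  have hηr : M * (η ^ 2 / M ^ 2) = (η * r) ^ 2 := by
    rw [mul_pow, hrinv]; field_simp
  have hsmall : η ^ 2 / M ^ 2 ≤ (η * r) ^ 2 := by
    rw [← hηr]
    exact le_mul_of_one_le_left (by positivity) hM
  have hηr0 : 0 < η * r := mul_pos hη hr
  have e1 : e ≤ 5 / 2 * (η * r) := by
    refine le_of_sq_le_sq ?_ (by positivity)
    nlinarith
  have z1 : z ≤ 2 * (η * r) := by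
    refine le_of_sq_le_sq ?_ (by positivity)
    nlinarith
  have p1 : p ≤ 2 * (η * r) := by
    refine le_of_sq_le_sq ?_ (by positivity)
    nlinarith
  have hae : 9 / 10 * r ≤ a + e := by
    refine le_of_sq_le_sq ?_ (by positivity)
    have h1 : η ^ 2 / M ^ 2 ≤ 1 / 10000 := by
      have : η ^ 2 ≤ 1 / 10000 := by nlinarith
      refine (div_le_self (by positivity) ?_).trans this
      nlinarith
    have h2 : (81 / 100 : ℝ) * (r ^ 2 * M) ≤ M * (a + e) ^ 2 := by rw [hrM]; linarith
    have h3 : (81 / 100 : ℝ) * r ^ 2 ≤ (a + e) ^ 2 := by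
      refine le_of_mul_le_mul_right ?_ hM0
      linarith
    nlinarith
  have hηr1 : η * r ≤ 1 / 100 * r := by nlinarith
  -- From `b ≥ a - z` and `a + e ≥ 9/10 * r`, where `e` and `z` are at most a few hundredths of `r`.
  -- Then `p + e + z ≤ 13/2 * η * r ≤ 13 * η * b`.
  have hb : r / 2 ≤ b := by nlinarith
  refine ⟨by linarith, ?_⟩
  have : η * (r / 2) ≤ η * b := mul_le_mul_of_nonneg_left hb hη.le
  nlinarith

/-- The legal initial part `u` is compared with the actual final slice. Drift, illegal input and
final rejection are all small relative to `‖u‖`, so the circuit run on `u` itself nearly passes the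
swap test. -/
theorem low_energy_sound {I : Type} [Fintype I]
    (Φ : Matrix (MsgQubit n C.length → Bool) I ℂ) (hρ : IsDensity (Φ * Φᴴ)) {η : ℝ} (hη : 0 < η)
    (hη0 : η ≤ 1 / 100)
    (hE : energy (fun j => gateAt C j) (Φ * Φᴴ) ≤
      3 * (η ^ 2 / ((n + C.length + 3 : ℕ) + 1) ^ 2)) :
    0 < advProb (Φ * Φᴴ) ∧
      hellinger (circuitDist C) (advDist (Φ * Φᴴ)) ≤ 20 * η := by
  set L := n + C.length + 3 with hL
  set M : ℝ := (L : ℝ) + 1 with hM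
  have hM1 : 1 ≤ M := by simp [hM]
  have hM0 : 0 < M := by linarith
  set s := η ^ 2 / M ^ 2 with hs
  have hs0 : 0 ≤ s := by positivity
  rw [energy_mixture (fun j => gateAt_unitary C j)] at hE
  set v := slice Φ with hv
  have hclock : ∑ j ∈ Finset.range (L + 1), ‖v j‖ ^ 2 ≤ 1 := by
    have := sum_clockWeight_le_one hρ
    simpa only [clockWeight_mixture] using this
  have hsum : ∑ j : Fin L, ‖v (j + 1) - gateAt C j * v j‖ ^ 2 / 2 =
      (∑ j ∈ Finset.range L, ‖v (j + 1) - gateAt C j * v j‖ ^ 2) / 2 := by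
    rw [Finset.sum_div]
    exact Fin.sum_univ_eq_sum_range (fun j => ‖v (j + 1) - gateAt C j * v j‖ ^ 2 / 2) L
  rw [hsum] at hE
  set dsum := ∑ j ∈ Finset.range L, ‖v (j + 1) - gateAt C j * v j‖ ^ 2 with hdsum
  have hd0 : 0 ≤ dsum := Finset.sum_nonneg fun _ _ => sq_nonneg _
  set u := inputProj (v 0) with hu
  have hz0 := sq_nonneg ‖v 0 - u‖
  have ho0 : 0 ≤ M⁻¹ * ‖outProj (v L)‖ ^ 2 := by positivity
  set e := √(M * (6 * s)) with he
  have he0 : 0 ≤ e := Real.sqrt_nonneg _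
  have he2 : e ^ 2 = M * (6 * s) := Real.sq_sqrt (by positivity)
  -- Cauchy–Schwarz over at most `M` steps, whose squared defects add up to at most `6 * s`; the 6
  -- is `3 * s` times 2, the propagation energy being half a square.
  have hdrift : ∀ j ≤ L, ‖v j - evolution C j * v 0‖ ≤ e := by
    intro j hj
    refine (norm_sub_evolution_le C v j).trans (le_of_sq_le_sq ?_ he0)
    rw [he2]
    calc (∑ i ∈ Finset.range j, ‖v (i + 1) - gateAt C i * v i‖) ^ 2
        ≤ (Finset.range j).card * ∑ i ∈ Finset.range j, ‖v (i + 1) - gateAt C i * v i‖ ^ 2 :=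
          sq_sum_le_card_mul_sum_sq
      _ ≤ M * dsum := by
          rw [Finset.card_range]
          have hjM : (j : ℝ) ≤ M := by
            have : (j : ℝ) ≤ L := by exact_mod_cast hj
            linarith
          refine mul_le_mul hjM ?_ (Finset.sum_nonneg fun _ _ => sq_nonneg _) hM0.le
          exact Finset.sum_le_sum_of_subset_of_nonneg (Finset.range_mono hj)
            fun _ _ _ => sq_nonneg _
      _ ≤ M * (6 * s) := by
          refine mul_le_mul_of_nonneg_left ?_ hM0.le
          linarith
  -- Every slice has norm at most `‖v 0‖ + e`, so nearly all of the unit mass being on legal clock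
  -- values bounds `‖v 0‖` from below.
  have hmass : 1 - 3 * s ≤ M * (‖v 0‖ + e) ^ 2 := by
    have h1 : ∀ j ∈ Finset.range (L + 1), ‖v j‖ ^ 2 ≤ (‖v 0‖ + e) ^ 2 := by
      intro j hj
      refine pow_le_pow_left₀ (norm_nonneg _) ?_ 2
      have h2 := hdrift j (by simpa [Nat.lt_succ_iff] using hj)
      have h3 : ‖v j‖ ≤ ‖evolution C j * v 0‖ + ‖v j - evolution C j * v 0‖ :=
        norm_le_norm_add_norm_sub' _ _
      rw [frobenius_unitary_mul (evolution_unitary C j)] at h3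
      linarith
    have h2 := Finset.sum_le_sum h1
    rw [Finset.sum_const, Finset.card_range, nsmul_eq_mul] at h2
    push_cast at h2
    linarith
  have hpM : ‖outProj (v L)‖ ^ 2 ≤ M * (3 * s) := by
    rw [← inv_mul_le_iff₀ hM0]
    linarith
  have hab : ‖v 0‖ ≤ ‖u‖ + ‖v 0 - u‖ := norm_le_norm_add_norm_sub' _ _
  obtain ⟨hu0, hfin⟩ := low_energy_numeric (r := 1 / √M) hM1 hη hη0 (by positivity)
    (by rw [div_pow, Real.sq_sqrt hM0.le]; field_simp) (norm_nonneg (v 0)) he0 hmass he2.le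
    (by linarith) hpM hab
  have hout : ‖outProj (evolution C L * u)‖ ≤ 14 * η * ‖u‖ := by
    have hdec : evolution C L * u = v L + (-(v L - evolution C L * v 0) +
        -(evolution C L * (v 0 - u))) := by
      rw [Matrix.mul_sub]
      abel
    rw [hdec, outProj_add]
    refine (norm_add_le _ _).trans ?_
    have h1 := (norm_outProj_le (-(v L - evolution C L * v 0) +
        -(evolution C L * (v 0 - u)))).trans (norm_add_le _ _)
    rw [norm_neg, norm_neg, frobenius_unitary_mul (evolution_unitary C L)] at h1
    linarith [hdrift L le_rfl]
  have hq : 0 < advProb (Φ * Φᴴ) := by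
    rw [advProb_mixture]
    positivity
  refine ⟨hq, ?_⟩
  set ψ : (Fin n → Bool) → I → ℂ := fun x i => slice Φ 0 (compInput x) i with hψ
  have hqψ : advProb (Φ * Φᴴ) = ∑ x, ∑ i, ‖ψ x i‖ ^ 2 :=
    Finset.sum_congr rfl fun x _ => advWeight_mixture Φ x
  have hswap : ‖outProj (evolution C L * u)‖ ^ 2 = (advProb (Φ * Φᴴ) -
      ∑ i, ‖∑ x, star (circuitState C x) * ψ x i‖ ^ 2) / 2 := by
    rw [norm_outProj_sq, hqψ, Finset.sum_comm (γ := Fin n → Bool), ← Finset.sum_sub_distrib,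
      Finset.sum_div]
    have h1 : ∀ d : CompQubit n → Bool, (if d CompQubit.out then (0 : ℝ) else
        ∑ i, ‖(evolution C L * u) d i‖ ^ 2) = ∑ i, if d CompQubit.out then (0 : ℝ) else
          ‖(evolution C L * u) d i‖ ^ 2 := by
      intro d
      split_ifs <;> simp
    simp_rw [h1]
    rw [Finset.sum_comm]
    refine Finset.sum_congr rfl fun i _ => ?_
    rw [← swapTest_norm C fun x => ψ x i]
    refine Finset.sum_congr rfl fun d _ => ?_
    have h2 : (evolution C L * u) d i = (evolution C L *ᵥ fun d => u d i) d := rfl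
    rw [h2, slice_inputProj_col, evolution_mulVec C le_rfl, List.take_of_length_le
      (length_comparisonGates C).le]
  -- The swap test gives a loss of at most `2 * 14 ^ 2 * η ^ 2 = 392 * η ^ 2` relative to `advProb`,
  -- rounded up to `(20 * η) ^ 2`.
  have hover : (1 - (20 * η) ^ 2) * advProb (Φ * Φᴴ) ≤
      ∑ i, ‖∑ x, star (circuitState C x) * ψ x i‖ ^ 2 := by
    have h1 := pow_le_pow_left₀ (norm_nonneg _) hout 2
    rw [hswap, mul_pow, ← advProb_mixture] at h1
    nlinarith [mul_nonneg (sq_nonneg η) hq.le]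
  have hfinal := hellinger_le_of_overlap (sum_circuitDist C) hqψ hq hover
  have hdist : advDist (Φ * Φᴴ) = fun x => (∑ i, ‖ψ x i‖ ^ 2) / advProb (Φ * Φᴴ) := by
    ext x
    rw [advDist, advWeight_mixture]
  rw [hdist]
  exact le_of_sq_le_sq hfinal (by positivity)

end LowEnergy

end QVerifier

end

noncomputable section

namespace QVerifier

attribute [local instance] Matrix.frobeniusNormedAddCommGroup

/-! ### The honest prover -/

section Honest

variable {n : ℕ} (C : List (Gate (Fin n)))

theorem norm_alignPhase (ψ : (Fin n → Bool) → ℂ) (x : Fin n → Bool) :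
    ‖alignPhase C ψ x‖ = ‖ψ x‖ := by
  rw [alignPhase, norm_mul, Complex.norm_exp_ofReal_mul_I, one_mul]

theorem norm_sq_alignPhase_qsample {D : (Fin n → Bool) → ℝ} (hD : ∀ x, 0 ≤ D x)
    (x : Fin n → Bool) : ‖alignPhase C (qsample D) x‖ ^ 2 = D x := by
  rw [norm_alignPhase, qsample, Complex.norm_real, Real.norm_eq_abs, sq_abs, Real.sq_sqrt (hD x)]

/-- The phase cancels the argument of each amplitude, making the quantum overlap equal to the
Bhattacharyya coefficient of the two distributions. -/
theorem star_circuitState_mul_alignPhase (D : (Fin n → Bool) → ℝ) (x : Fin n → Bool) :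
    star (circuitState C x) * alignPhase C (qsample D) x =
      ((√(D x) * √(circuitDist C x) : ℝ) : ℂ) := by
  have h := Complex.norm_mul_exp_arg_mul_I (circuitState C x)
  have h1 : star (circuitState C x) * Complex.exp ((circuitState C x).arg * Complex.I) =
      (‖circuitState C x‖ : ℂ) := by
    set e := Complex.exp ((circuitState C x).arg * Complex.I) with he
    have he1 : (starRingEnd ℂ) e * e = 1 := by
      rw [Complex.conj_mul', he, Complex.norm_exp_ofReal_mul_I]
      simp
    rw [Complex.star_def, ← h, map_mul, Complex.conj_ofReal, mul_assoc, he1, mul_one, h]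
  rw [alignPhase, ← mul_assoc, h1, qsample, circuitDist, Real.sqrt_sq (norm_nonneg _)]
  push_cast
  ring

theorem historyState_timeState (ψ : (Fin n → Bool) → ℂ) {j : ℕ} (hj : j ≤ n + C.length + 3)
    (d : CompQubit n → Bool) : historyState C ψ (timeState C.length j d) =
      (1 / (√((n + C.length + 3 : ℕ) + 1 : ℝ) : ℝ) : ℂ) *
        applyAll ((comparisonGates C).take j) (inputState ψ) d := by
  rw [historyState, Finset.sum_eq_single j]
  · exact congrArg _ (if_pos rfl)
  · intro j' hj' hne
    rw [if_neg]
    intro h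
    exact hne (unary_injective (by simpa [Nat.lt_succ_iff] using hj') hj h.symm)
  · intro h
    exact absurd (Finset.mem_range.2 (by omega)) h

theorem historyState_illegal (ψ : (Fin n → Bool) → ℂ) (z : MsgQubit n C.length → Bool)
    (hz : ∀ j ≤ n + C.length + 3, clockPart z ≠ unary (n + C.length + 3) j) :
    historyState C ψ z = 0 := by
  rw [historyState, Finset.sum_eq_zero, mul_zero]
  intro j hj
  exact if_neg (hz j (by simpa [Nat.lt_succ_iff] using hj))

/-- The history state as an ensemble with one member. -/
def historyCol (ψ : (Fin n → Bool) → ℂ) : Matrix (MsgQubit n C.length → Bool) Unit ℂ :=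
  Matrix.of fun z _ => historyState C ψ z

theorem pureState_historyState (ψ : (Fin n → Bool) → ℂ) :
    pureState (historyState C ψ) = historyCol C ψ * (historyCol C ψ)ᴴ := by
  ext x y
  simp [pureState, Matrix.vecMulVec_apply, Matrix.mul_apply, historyCol]

theorem slice_historyCol (ψ : (Fin n → Bool) → ℂ) {j : ℕ} (hj : j ≤ n + C.length + 3)
    (d : CompQubit n → Bool) (i : Unit) : slice (historyCol C ψ) j d i =
      (1 / (√((n + C.length + 3 : ℕ) + 1 : ℝ) : ℝ) : ℂ) *
        applyAll ((comparisonGates C).take j) (inputState ψ) d :=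
  historyState_timeState C ψ hj d

theorem norm_sq_inv_sqrt_mul {M : ℝ} (hM : 0 < M) (z : ℂ) :
    ‖(1 / ((√M : ℝ) : ℂ)) * z‖ ^ 2 = M⁻¹ * ‖z‖ ^ 2 := by
  rw [norm_mul, norm_div, norm_one, Complex.norm_real, Real.norm_eq_abs, mul_pow, div_pow, sq_abs,
    Real.sq_sqrt hM.le, one_pow, one_div]

theorem norm_slice_historyCol {ψ : (Fin n → Bool) → ℂ} (hψ : ∑ x, ‖ψ x‖ ^ 2 = 1) {j : ℕ}
    (hj : j ≤ n + C.length + 3) :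
    ‖slice (historyCol C ψ) j‖ ^ 2 = ((n + C.length + 3 : ℕ) + 1 : ℝ)⁻¹ := by
  rw [frobenius_sq]
  simp only [slice_historyCol C ψ hj, norm_sq_inv_sqrt_mul
    (show (0 : ℝ) < (n + C.length + 3 : ℕ) + 1 by positivity), Finset.univ_unique,
    Finset.sum_singleton, ← Finset.mul_sum]
  rw [sum_norm_sq_applyAll (fun A hA => comparisonGates_unitary C (List.mem_of_mem_take hA)),
    sum_inputState_norm_sq, hψ, mul_one]

theorem isDensity_historyState {ψ : (Fin n → Bool) → ℂ} (hψ : ∑ x, ‖ψ x‖ ^ 2 = 1) :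
    IsDensity (pureState (historyState C ψ)) := by
  refine ⟨by
    rw [pureState_historyState]
    exact Matrix.posSemidef_self_mul_conjTranspose _, ?_⟩
  have h1 : ∀ z, ‖historyState C ψ z‖ ^ 2 = ∑ j ∈ Finset.range (n + C.length + 3 + 1),
      if clockPart z = unary (n + C.length + 3) j then ‖historyState C ψ z‖ ^ 2 else 0 := by
    intro z
    by_cases hz : ∃ j ≤ n + C.length + 3, clockPart z = unary (n + C.length + 3) j
    · obtain ⟨j, hj, hz⟩ := hz
      rw [Finset.sum_eq_single j, if_pos hz]
      · intro j' hj' hne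
        rw [if_neg]
        intro h
        exact hne (unary_injective (by simpa [Nat.lt_succ_iff] using hj') hj (h.symm.trans hz))
      · intro h
        exact absurd (Finset.mem_range.2 (by omega)) h
    · push Not at hz
      rw [historyState_illegal C ψ z hz]
      simp
  have h2 : ∑ z, ‖historyState C ψ z‖ ^ 2 = 1 := by
    rw [Finset.sum_congr rfl fun z _ => h1 z, Finset.sum_comm]
    simp_rw [sum_clock_eq (fun z => ‖historyState C ψ z‖ ^ 2)]
    have h3 : ∀ j ∈ Finset.range (n + C.length + 3 + 1),
        ∑ d, ‖historyState C ψ (timeState C.length j d)‖ ^ 2 =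
          ((n + C.length + 3 : ℕ) + 1 : ℝ)⁻¹ := by
      intro j hj
      rw [← norm_slice_historyCol C hψ (by simpa [Nat.lt_succ_iff] using hj), frobenius_sq]
      simp [slice, historyCol]
    rw [Finset.sum_congr rfl h3, Finset.sum_const, Finset.card_range, nsmul_eq_mul]
    have : ((n + C.length + 3 : ℕ) : ℝ) + 1 ≠ 0 := by positivity
    rw [Nat.cast_add_one, mul_inv_cancel₀ this]
  simp only [Matrix.trace, Matrix.diag_apply, pureState, Matrix.vecMulVec_apply, Pi.star_apply,
    Complex.star_def, Complex.mul_conj']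
  exact_mod_cast h2

theorem advWeight_historyState (ψ : (Fin n → Bool) → ℂ) (x : Fin n → Bool) :
    advWeight (pureState (historyState C ψ)) x =
      ((n + C.length + 3 : ℕ) + 1 : ℝ)⁻¹ * ‖ψ x‖ ^ 2 := by
  rw [pureState_historyState, advWeight_mixture]
  simp only [slice_historyCol C ψ (Nat.zero_le _), norm_sq_inv_sqrt_mul
    (show (0 : ℝ) < (n + C.length + 3 : ℕ) + 1 by positivity), Finset.univ_unique,
    Finset.sum_singleton, List.take_zero, applyAll_nil]
  congr 3
  exact if_pos rfl

/-- A history state has no clock, input or propagation defect. Only the final rejection remains,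
with one factor `1/M` from its penalty and another from the mass of the final slice. -/
theorem energy_historyState_le {D : (Fin n → Bool) → ℝ} (hD : D ∈ stdSimplex ℝ (Fin n → Bool))
    {η : ℝ} (hη : hellinger D (circuitDist C) ≤ η) :
    energy (fun j => gateAt C j)
        (pureState (historyState C (alignPhase C (qsample D)))) ≤
      η ^ 2 / ((n + C.length + 3 : ℕ) + 1) ^ 2 := by
  set ψ := alignPhase C (qsample D) with hψdef
  have hψ : ∑ x, ‖ψ x‖ ^ 2 = 1 := by
    simp only [hψdef, norm_sq_alignPhase_qsample C hD.1]
    exact hD.2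
  have hM : (0 : ℝ) < (n + C.length + 3 : ℕ) + 1 := by positivity
  rw [pureState_historyState, energy_mixture (fun j => gateAt_unitary C j)]
  have h1 : ∑ j ∈ Finset.range (n + C.length + 3 + 1), ‖slice (historyCol C ψ) j‖ ^ 2 = 1 := by
    rw [Finset.sum_congr rfl fun j hj =>
      norm_slice_historyCol C hψ (by simpa [Nat.lt_succ_iff] using hj), Finset.sum_const,
      Finset.card_range, nsmul_eq_mul, Nat.cast_add_one, mul_inv_cancel₀ hM.ne']
  have h2 : slice (historyCol C ψ) 0 - inputProj (slice (historyCol C ψ) 0) = 0 := by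
    ext d i
    rw [Matrix.sub_apply, inputProj]
    by_cases hd : d = compInput (advPart d)
    · rw [if_pos hd, sub_self, Matrix.zero_apply]
    · rw [if_neg hd, sub_zero, slice_historyCol C ψ (Nat.zero_le _)]
      have : inputState ψ d = 0 := if_neg hd
      simp [applyAll_nil, this]
  have h3 : ∀ j : Fin (n + C.length + 3), slice (historyCol C ψ) (j + 1) -
      gateAt C j * slice (historyCol C ψ) j = 0 := by
    intro j
    rw [sub_eq_zero]
    ext d i
    rw [slice_historyCol C ψ j.2, applyAll_take_succ C j.2, Matrix.mul_apply]
    simp only [slice_historyCol C ψ j.2.le, Matrix.mulVec, dotProduct, Finset.mul_sum]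
    exact Finset.sum_congr rfl fun y _ => by ring
  have hover : ‖∑ x, star (circuitState C x) * ψ x‖ = 1 - hellinger D (circuitDist C) ^ 2 := by
    rw [hellinger_sq (Q := circuitDist C) hD.1 (fun x => sq_nonneg _) hD.2 (sum_circuitDist C)]
    simp only [hψdef, star_circuitState_mul_alignPhase]
    rw [← Complex.ofReal_sum, Complex.norm_real, Real.norm_eq_abs, abs_of_nonneg]
    · ring
    · exact Finset.sum_nonneg fun _ _ => by positivity
  have h4 : ‖outProj (slice (historyCol C ψ) (n + C.length + 3))‖ ^ 2 ≤
      ((n + C.length + 3 : ℕ) + 1 : ℝ)⁻¹ * η ^ 2 := by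
    rw [norm_outProj_sq]
    have h5 : ∀ d : CompQubit n → Bool, (if d CompQubit.out then (0 : ℝ) else
        ∑ i, ‖slice (historyCol C ψ) (n + C.length + 3) d i‖ ^ 2) =
        ((n + C.length + 3 : ℕ) + 1 : ℝ)⁻¹ * (if d CompQubit.out then 0 else
          ‖applyAll (comparisonGates C) (inputState ψ) d‖ ^ 2) := by
      intro d
      simp only [slice_historyCol C ψ le_rfl, norm_sq_inv_sqrt_mul hM, Finset.univ_unique,
        Finset.sum_singleton, List.take_of_length_le (length_comparisonGates C).le]
      split_ifs <;> simp
    simp_rw [h5, ← Finset.mul_sum]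
    rw [swapTest_norm, hψ, hover]
    refine mul_le_mul_of_nonneg_left ?_ (by positivity)
    have hh := pow_le_pow_left₀ (hellinger_nonneg D (circuitDist C)) hη 2
    -- With `h` the Hellinger distance, `(1 - (1 - h²)²) / 2 = h² - h⁴ / 2 ≤ η²`.
    nlinarith [sq_nonneg (hellinger D (circuitDist C) ^ 2)]
  rw [h1, h2]
  simp only [h3, norm_zero]
  calc _ ≤ (1 - 1 + 0 ^ 2 + ((n + C.length + 3 : ℕ) + 1 : ℝ)⁻¹ *
        (((n + C.length + 3 : ℕ) + 1 : ℝ)⁻¹ * η ^ 2) + ∑ _j : Fin (n + C.length + 3),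
          (0 : ℝ) ^ 2 / 2) := by gcongr
    _ = _ := by
        simp
        field_simp

end Honest

end QVerifier

end

noncomputable section

namespace QVerifier

/-! ### The verifier -/

section EnergyVerifier

variable {n T : ℕ}

/-- The sample, if any, that the record of a round contains. -/
def roundSample : EnergyCoin n T × (MsgQubit n T → Bool) → Option (Fin n → Bool)
  | (none, b) => if clockPart b = unary (n + T + 3) 0 ∧ dataPart b = compInput (advPart (dataPart b))
      then some (advPart (dataPart b)) else none
  | (some _, _) => none

variable (G : Fin (n + T + 3) → Matrix (CompQubit n → Bool) (CompQubit n → Bool) ℂ)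
  (W : Fin (n + T + 3) → Finset (CompQubit n))

/-- The verifier that estimates the energy in `N` rounds, compares it with the threshold `θ`, and
collects the samples from the rounds in which all qubits are measured in the `Z` basis. -/
def energyVerifier (θ : ℝ) (N : ℕ) : Verifier (MsgQubit n T) n where
  rounds := N
  Coin := EnergyCoin n T
  fintypeCoin := inferInstance
  coinDist := coinWeight
  coinDist_mem := ⟨coinWeight_nonneg, sum_coinWeight⟩
  basis := coinBasis
  output := fun τ => if ∑ r, energyStat G W (τ r) ≤ N * θ then some (samples roundSample τ) else none

variable {G W}

theorem roundSample_none_eq_some {b : MsgQubit n T → Bool} {x : Fin n → Bool} :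
    roundSample (none, b) = some x ↔ b = timeState T 0 (compInput x) := by
  simp only [roundSample]
  constructor
  · intro h
    split_ifs at h with hb
    obtain rfl := Option.some.inj h
    ext (i | i)
    · exact congrFun hb.1 i
    · exact congrFun hb.2 i
  · rintro rfl
    exact if_pos ⟨rfl, rfl⟩

/-- A sample requires a legal clock at time 0, a legal input, and a time that is not final, so every
penalty vanishes. This decouples the sampled values from the energy test. -/
theorem energyStat_eq_zero_of_roundSample {ω : EnergyCoin n T × (MsgQubit n T → Bool)}
    {x : Fin n → Bool} (h : roundSample ω = some x) : energyStat G W ω = 0 := by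
  rcases ω with ⟨_ | c, b⟩
  · rw [roundSample_none_eq_some] at h
    have hc : clockPart b = unary (n + T + 3) 0 := by rw [h]; rfl
    have hd : dataPart b = compInput (advPart (dataPart b)) := by rw [h]; rfl
    rw [energyStat, zPenalty, if_pos hc, if_pos hd, if_neg, Finset.sum_eq_single 0, if_pos hc]
    · simp
    · intro j hj hne
      rw [if_neg]
      intro h'
      exact hne (unary_injective (by simpa [Nat.lt_succ_iff] using hj) (Nat.zero_le _)
        (h'.symm.trans hc))
    · simp
    · intro h'
      have := unary_injective (Nat.zero_le _) le_rfl (hc.symm.trans h')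
      omega
  · simp [roundSample] at h

variable {ρ : Matrix (MsgQubit n T → Bool) (MsgQubit n T → Bool) ℂ}

theorem sum_roundSample_eq (x : Fin n → Bool) :
    ∑ ω, roundLaw ρ ω * ind (roundSample ω = some x) = 1 / 2 * advWeight ρ x := by
  have h0 : ∀ (j : Fin (n + T + 3)) (β : MsgQubit n T → PauliBasis) (b : MsgQubit n T → Bool),
      roundSample (some (j, β), b) ≠ some x := fun j β b => by simp [roundSample]
  rw [sum_round]
  simp only [roundSample_none_eq_some, ind_neg (h0 _ _ _), ind_eq_ite, mul_boole, mul_zero,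
    Finset.sum_const_zero, add_zero, Finset.sum_ite_eq', Finset.mem_univ, if_true]
  rw [timeState_zero]
  rfl

theorem sum_roundSample_isSome :
    ∑ ω, roundLaw ρ ω * ind ((roundSample (n := n) (T := T) ω).isSome = true) =
      1 / 2 * advProb ρ := by
  rw [advProb, Finset.mul_sum]
  simp_rw [← sum_roundSample_eq]
  rw [Finset.sum_comm]
  refine Finset.sum_congr rfl fun ω _ => ?_
  cases h : roundSample ω <;> simp [ind_eq_ite]

theorem energyVerifier_prob {θ : ℝ} {N : ℕ} {E : Set (Option (List (Fin n → Bool)))}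
    {P : List (Fin n → Bool) → Prop} (hE : none ∉ E) (hP : ∀ l, some l ∈ E ↔ P l) :
    (energyVerifier G W θ N).prob ρ E =
      ∑ τ : Fin N → EnergyCoin n T × (MsgQubit n T → Bool), (∏ r, roundLaw ρ (τ r)) *
        ind (∑ r, energyStat G W (τ r) ≤ N * θ) * ind (P (samples roundSample τ)) := by
  classical
  have key : ∀ τ : Fin N → EnergyCoin n T × (MsgQubit n T → Bool),
      (if (if ∑ r, energyStat G W (τ r) ≤ N * θ then some (samples roundSample τ) else none) ∈ E
        then ∏ r, roundLaw ρ (τ r) else 0) =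
      (∏ r, roundLaw ρ (τ r)) * ind (∑ r, energyStat G W (τ r) ≤ N * θ) *
        ind (P (samples roundSample τ)) := by
    intro τ
    by_cases h1 : ∑ r, energyStat G W (τ r) ≤ N * θ
    · simp only [if_pos h1, ind_pos h1, ind_eq_ite, mul_one, mul_boole, hP]
    · simp only [if_neg h1, ind_neg h1, if_neg hE, mul_zero, zero_mul]
  exact Finset.sum_congr rfl fun τ _ => (Set.indicator_apply _ _ _).trans (key τ)

/-- Acceptance is a function `h` of the summed statistic alone, so `samples_iid` applies with `h`
the indicator of passing the threshold. No low-energy assumption is involved. -/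
theorem energyVerifier_samplesIID {D : (Fin n → Bool) → ℝ}
    (hD : ∀ x, advWeight ρ x = advProb ρ * D x) (θ : ℝ) (N : ℕ) :
    (energyVerifier G W θ N).SamplesIID ρ D := by
  intro S
  rw [energyVerifier_prob (P := fun l => l = S) (by simp) (by simp),
    energyVerifier_prob (P := fun l => l.length = S.length) (by simp) (by simp)]
  exact samples_iid (p := roundLaw ρ) (X := energyStat G W) (samp := roundSample) (D := D)
    (q := 1 / 2 * advProb ρ) (fun ω x hx => energyStat_eq_zero_of_roundSample hx)
    (fun x => by rw [sum_roundSample_eq, hD, mul_assoc])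
    sum_roundSample_isSome N (fun a => ind (a ≤ N * θ)) S

variable {k : ℕ} {B : ℝ}

/-- If the energy is at most `s`, the energy test passes and many samples are found. -/
theorem energyVerifier_complete (hρ : IsDensity ρ) (hG : ∀ j, IsLocalOn (W j) (G j))
    (hGU : ∀ j, G j ∈ Matrix.unitaryGroup (CompQubit n → Bool) ℂ) (hW : ∀ j, (W j).card ≤ k)
    (hB : B = 4 * 12 ^ k) {s ε c : ℝ} (hs : 0 ≤ s) (hs1 : s ≤ 1) (hE : energy G ρ ≤ s)
    (hq : 0 < advProb ρ) {N : ℕ}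
    (h1 : Real.exp (-(N * (s ^ 2 / (4 * (22 * ((n + T + 3 : ℕ) + 1) * B ^ 2))))) ≤ ε)
    (h2 : Real.exp (-(N * (advProb ρ / 32))) ≤ ε) (hc : c ≤ N * (advProb ρ / 4)) :
    1 - 2 * ε ≤ (energyVerifier G W (2 * s) N).prob ρ
      {o | ∃ S : List (Fin n → Bool), o = some S ∧ c ≤ (S.length : ℝ)} := by
  have hB1 : 1 ≤ B := by
    have h4 : (1 : ℝ) ≤ 12 ^ k := one_le_pow₀ (by norm_num)
    linarith
  have hM : (1 : ℝ) ≤ (n + T + 3 : ℕ) + 1 := by simp; positivity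
  have hMB : 0 < ((n + T + 3 : ℕ) + 1 : ℝ) * B := by positivity
  have hp0 := roundLaw_nonneg hρ
  have hp1 := sum_roundLaw hρ
  have t1 := upper_tail_le N hp0 hp1 (abs_energyStat_le hB hW hGU)
    (secondMoment_energyStat_le hρ hB hW hGU) (by positivity) hs (by nlinarith)
    ((mean_energyStat hρ hG).le.trans hE)
  have hmean := sum_roundSample_isSome (ρ := ρ)
  have hind : ∀ P : Prop, |ind P| ≤ 1 ∧ ind P ^ 2 = ind P := by
    intro P
    by_cases h : P
    · simp [ind_pos h]
    · simp [ind_neg h]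
  -- An indicator has second moment equal to its mean `advProb ρ / 2`; deviating by half of that
  -- mean gives the exponent `advProb ρ / 32`.
  have t2 := lower_tail_le N (X := fun ω => ind ((roundSample ω).isSome = true)) hp0 hp1
    (R := 1) (V := 1 / 2 * advProb ρ) (s := 1 / 4 * advProb ρ) (μ := 1 / 2 * advProb ρ)
    (fun ω => (hind _).1) (by simp only [(hind _).2]; exact hmean.le)
    (by positivity) (by positivity) (by linarith) hmean.ge
  have e2 : (1 / 4 * advProb ρ) ^ 2 / (4 * (1 / 2 * advProb ρ)) = advProb ρ / 32 := by
    field_simp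
    norm_num
  rw [e2] at t2
  rw [energyVerifier_prob (P := fun l => c ≤ (l.length : ℝ)) (by simp) (by simp)]
  -- A union bound: a record either passes with enough samples, or has a large statistic, or has few
  -- samples.
  have hle := Finset.sum_le_sum fun (τ : Fin N → EnergyCoin n T × (MsgQubit n T → Bool))
      (_ : τ ∈ Finset.univ) =>
    show ∏ r, roundLaw ρ (τ r) ≤ (∏ r, roundLaw ρ (τ r)) *
        ind (∑ r, energyStat G W (τ r) ≤ N * (2 * s)) *
          ind (c ≤ ((samples roundSample τ).length : ℝ)) +
      (∏ r, roundLaw ρ (τ r)) * ind (N * (s + s) ≤ ∑ r, energyStat G W (τ r)) +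
      (∏ r, roundLaw ρ (τ r)) * ind (∑ r, ind ((roundSample (τ r)).isSome = true) ≤
          N * (1 / 2 * advProb ρ - 1 / 4 * advProb ρ)) by
    have hpos : 0 ≤ ∏ r, roundLaw ρ (τ r) := Finset.prod_nonneg fun r _ => hp0 _
    have hnn : ∀ P : Prop, 0 ≤ (∏ r, roundLaw ρ (τ r)) * ind P :=
      fun P => mul_nonneg hpos (ind_nonneg P)
    have hnn2 := mul_nonneg (hnn (∑ r, energyStat G W (τ r) ≤ N * (2 * s)))
      (ind_nonneg (c ≤ ((samples roundSample τ).length : ℝ)))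
    by_cases c1 : N * (s + s) ≤ ∑ r, energyStat G W (τ r)
    · rw [ind_pos c1]
      linarith [hnn (∑ r, ind ((roundSample (τ r)).isSome = true) ≤
          N * (1 / 2 * advProb ρ - 1 / 4 * advProb ρ))]
    by_cases c2 : ∑ r, ind ((roundSample (τ r)).isSome = true) ≤
          N * (1 / 2 * advProb ρ - 1 / 4 * advProb ρ)
    · rw [ind_pos c2]
      linarith [hnn (N * (s + s) ≤ ∑ r, energyStat G W (τ r))]
    · rw [ind_neg c1, ind_neg c2, ind_pos (by linarith), ind_pos]
      · linarith
      · rw [length_samples]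
        linarith
  rw [sum_prod_eq_one N hp1, Finset.sum_add_distrib, Finset.sum_add_distrib] at hle
  linarith

/-- If the energy is at least `3 * s`, the energy test is likely to fail. -/
theorem energyVerifier_sound (hρ : IsDensity ρ) (hG : ∀ j, IsLocalOn (W j) (G j))
    (hGU : ∀ j, G j ∈ Matrix.unitaryGroup (CompQubit n → Bool) ℂ) (hW : ∀ j, (W j).card ≤ k)
    (hB : B = 4 * 12 ^ k) {s : ℝ} (hs : 0 ≤ s) (hs1 : s ≤ 1) (hE : 3 * s ≤ energy G ρ) (N : ℕ) :
    (energyVerifier G W (2 * s) N).prob ρ {o | o.isSome = true} ≤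
      Real.exp (-(N * (s ^ 2 / (4 * (22 * ((n + T + 3 : ℕ) + 1) * B ^ 2))))) := by
  have hB1 : 1 ≤ B := by
    have h4 : (1 : ℝ) ≤ 12 ^ k := one_le_pow₀ (by norm_num)
    linarith
  have hM : (1 : ℝ) ≤ (n + T + 3 : ℕ) + 1 := by simp; positivity
  have hMB : 0 < ((n + T + 3 : ℕ) + 1 : ℝ) * B := by positivity
  have t1 := lower_tail_le N (roundLaw_nonneg hρ) (sum_roundLaw hρ) (abs_energyStat_le hB hW hGU)
    (secondMoment_energyStat_le hρ hB hW hGU) (by positivity) hs (by nlinarith)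
    (hE.trans (mean_energyStat hρ hG).ge)
  have e : 3 * s - s = 2 * s := by ring
  rw [e] at t1
  rw [energyVerifier_prob (P := fun _ => True) (by simp) (by simp)]
  simpa only [ind_pos trivial, mul_one] using t1

end EnergyVerifier

-- The columns of `A` form an unnormalised ensemble for `ρ`; this carries the pure-state argument
-- over to mixed states.
open scoped MatrixOrder Matrix.Norms.L2Operator in
theorem exists_eq_mul_conjTranspose {X : Type} [Fintype X] {ρ : Matrix X X ℂ}
    (h : ρ.PosSemidef) : ∃ A : Matrix X X ℂ, ρ = A * Aᴴ := by
  classical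
  obtain ⟨A, rfl⟩ := CStarAlgebra.nonneg_iff_eq_star_mul_self.mp h.nonneg
  exact ⟨star A, by rw [← Matrix.star_eq_conjTranspose, star_star]⟩

/-! ### The choice of the parameters -/

/-- As `n ≥ 1`, `M ≤ 5 * (n + T)`, and `(n + T) ^ 5 ≤ 16 * (n ^ 5 + T ^ 5)`; this gives `5 ^ 5 * 16
= 50000`. Rounding up costs a factor 2 because the quantity is at least 1. The mixed term `n ^ 2 * T
^ 3` is only added. -/
theorem rounds_bound {n T K : ℕ} (hn : 1 ≤ n) {B η ℓ : ℝ} (hB : 1 ≤ B) (hK : 1 ≤ K) (hη : 0 < η)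
    (hη1 : η ≤ 1) (hℓ : 1 ≤ ℓ) :
    ((⌈200 * B ^ 2 * K * ((n + T + 3 : ℕ) + 1 : ℝ) ^ 5 / η ^ 4 * ℓ⌉₊ : ℕ) : ℝ) ≤
      20000000 * B ^ 2 * (K * ((n : ℝ) ^ 5 + (n : ℝ) ^ 2 * (T : ℝ) ^ 3 + (T : ℝ) ^ 5) / η ^ 4 *
        ℓ) := by
  have hK' : (1 : ℝ) ≤ K := by exact_mod_cast hK
  have hn' : (1 : ℝ) ≤ n := by exact_mod_cast hn
  have hT : (0 : ℝ) ≤ T := Nat.cast_nonneg _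
  have hM : ((n + T + 3 : ℕ) + 1 : ℝ) ≤ 5 * (n + T) := by push_cast; linarith
  have hM1 : (1 : ℝ) ≤ (n + T + 3 : ℕ) + 1 := by simp; positivity
  have hM5 : ((n + T + 3 : ℕ) + 1 : ℝ) ^ 5 ≤
      50000 * ((n : ℝ) ^ 5 + (n : ℝ) ^ 2 * (T : ℝ) ^ 3 + (T : ℝ) ^ 5) := by
    have h1 := pow_le_pow_left₀ (by linarith) hM 5
    have h2 := add_pow_le (show (0 : ℝ) ≤ n by linarith) hT 5
    have h3 : 0 ≤ (n : ℝ) ^ 2 * (T : ℝ) ^ 3 := by positivity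
    rw [mul_pow] at h1
    norm_num at h1 h2
    push_cast
    linarith
  set Q := 200 * B ^ 2 * K * ((n + T + 3 : ℕ) + 1 : ℝ) ^ 5 / η ^ 4 * ℓ with hQ
  have hη4 : η ^ 4 ≤ 1 := pow_le_one₀ hη.le hη1
  have hQ1 : 1 ≤ Q := by
    have h1 : (1 : ℝ) ≤ B ^ 2 := one_le_pow₀ hB
    have h2 : (1 : ℝ) ≤ ((n + T + 3 : ℕ) + 1 : ℝ) ^ 5 := one_le_pow₀ hM1
    have h3 : (1 : ℝ) ≤ 200 * B ^ 2 * K * ((n + T + 3 : ℕ) + 1 : ℝ) ^ 5 :=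
      one_le_mul_of_one_le_of_one_le (one_le_mul_of_one_le_of_one_le (by linarith) hK') h2
    refine one_le_mul_of_one_le_of_one_le ?_ hℓ
    rw [one_le_div (by positivity)]
    linarith
  have hceil := (Nat.ceil_lt_add_one (by linarith : 0 ≤ Q)).le
  have hQle : Q ≤ 200 * B ^ 2 * K * (50000 * ((n : ℝ) ^ 5 + (n : ℝ) ^ 2 * (T : ℝ) ^ 3 +
      (T : ℝ) ^ 5)) / η ^ 4 * ℓ := by
    rw [hQ]
    gcongr
  calc _ ≤ 2 * Q := by linarith
    _ ≤ 2 * (200 * B ^ 2 * K * (50000 * ((n : ℝ) ^ 5 + (n : ℝ) ^ 2 * (T : ℝ) ^ 3 +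
      (T : ℝ) ^ 5)) / η ^ 4 * ℓ) := by linarith
    _ = _ := by ring

theorem exp_neg_two_log_le {δ a : ℝ} (hδ : 0 < δ) (hδ1 : δ < 1 / 3)
    (ha : 2 * Real.log (1 / δ) ≤ a) : Real.exp (-a) ≤ δ / 2 := by
  calc Real.exp (-a) ≤ Real.exp (Real.log δ + Real.log δ) := by
        rw [Real.exp_le_exp]
        rw [one_div, Real.log_inv] at ha
        linarith
    _ = δ * δ := by rw [Real.exp_add, Real.exp_log hδ]
    _ ≤ δ / 2 := by nlinarith

theorem one_le_log_one_div {δ : ℝ} (hδ : 0 < δ) (hδ1 : δ < 1 / 3) : 1 ≤ Real.log (1 / δ) := by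
  rw [Real.le_log_iff_exp_le (by positivity)]
  have h : 3 < 1 / δ := by rw [lt_div_iff₀ hδ]; linarith
  linarith [Real.exp_one_lt_d9]

end QVerifier

end

/-! ### Choice of the verifier and of the constants. -/

theorem mainTheorem4 :
    ∃ η₀ > (0 : ℝ), ∃ cD > (0 : ℝ), ∃ cS > (0 : ℝ), ∀ k : ℕ, ∃ cN > (0 : ℝ),
      ∀ (n : ℕ) (_ : 1 ≤ n)
        (C : List (QVerifier.Gate (Fin n))) (_ : ∀ g ∈ C, g.arity ≤ k)
        (δ : ℝ) (_ : 0 < δ) (_ : δ < 1 / 3) (K : ℕ) (_ : 1 ≤ K)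
        (η : ℝ) (_ : 0 < η) (_ : η ≤ η₀),
      ∃ V : QVerifier.Verifier (QVerifier.MsgQubit n C.length) n,
        -- number of rounds and number of qubits per round
        (V.rounds : ℝ) ≤ cN * (K * ((n : ℝ) ^ 5 + (n : ℝ) ^ 2 * (C.length : ℝ) ^ 3
            + (C.length : ℝ) ^ 5) / η ^ 4 * Real.log (1 / δ)) ∧
        Fintype.card (QVerifier.MsgQubit n C.length) ≤ 7 * (n + C.length) ∧
        -- completeness, for the prover that sends history states
        (∀ D ∈ stdSimplex ℝ (Fin n → Bool),
          QVerifier.hellinger D (QVerifier.circuitDist C) ≤ η →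
          1 - δ ≤ V.prob
              (QVerifier.pureState
                (QVerifier.historyState C (QVerifier.alignPhase C (QVerifier.qsample D))))
              {o | ∃ S : List (Fin n → Bool), o = some S ∧ cS * (K : ℝ) ≤ (S.length : ℝ)} ∧
          V.SamplesIID
              (QVerifier.pureState
                (QVerifier.historyState C (QVerifier.alignPhase C (QVerifier.qsample D)))) D) ∧
        -- soundness, for every prover that sends a possibly mixed state
        (∀ ρ : Matrix (QVerifier.MsgQubit n C.length → Bool)
              (QVerifier.MsgQubit n C.length → Bool) ℂ,
          QVerifier.IsDensity ρ →
          2 / 3 ≤ V.prob ρ {o | o.isSome = true} →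
          0 < QVerifier.advProb ρ ∧
          V.SamplesIID ρ (QVerifier.advDist ρ) ∧
          QVerifier.hellinger (QVerifier.circuitDist C) (QVerifier.advDist ρ)
            ≤ cD * η ^ (1 / 4 : ℝ)) := by
  refine ⟨1 / 100, by norm_num, 20, by norm_num, 1, one_pos, fun k => ?_⟩
  -- Bounds the propagation estimates, `1/2 + 3 * 12 ^ (k + 3) ≤ B`, as every gate acts on at most
  -- `k + 3` qubits.
  set B : ℝ := 4 * 12 ^ (k + 3) with hB
  have hB1 : 1 ≤ B := by
    have h4 : (1 : ℝ) ≤ 12 ^ (k + 3) := one_le_pow₀ (by norm_num)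
    linarith
  refine ⟨20000000 * B ^ 2, by positivity, ?_⟩
  intro n hn C hC δ hδ hδ1 K hK η hη hη0
  have hlocal : ∀ j : Fin (n + C.length + 3), ∃ W : Finset (QVerifier.CompQubit n),
      W.card ≤ k + 3 ∧ QVerifier.IsLocalOn W (QVerifier.gateAt C j) := fun j =>
    (QVerifier.mem_comparisonGates hC (QVerifier.gateAt_mem C j)).2
  choose W hW hG using hlocal
  have hGU : ∀ j : Fin (n + C.length + 3), QVerifier.gateAt C j ∈
      Matrix.unitaryGroup (QVerifier.CompQubit n → Bool) ℂ := fun j =>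
    QVerifier.gateAt_unitary C j
  have hℓ := QVerifier.one_le_log_one_div hδ hδ1
  set ℓ := Real.log (1 / δ) with hℓdef
  set M : ℝ := (n + C.length + 3 : ℕ) + 1 with hM
  have hM1 : 1 ≤ M := by simp [hM]; positivity
  set s := η ^ 2 / M ^ 2 with hs
  have hs0 : 0 ≤ s := by positivity
  have hs1 : s ≤ 1 := by
    rw [hs, div_le_one (by positivity)]
    nlinarith
  have hη1 : η ≤ 1 := by linarith
  have hη4 : η ^ 4 ≤ 1 := pow_le_one₀ hη.le hη1
  -- Large enough for two tails: `N * s ^ 2 / (88 * M * B ^ 2) ≥ 200/88 * K * ℓ` for the energy, and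
  -- `N / M ≥ 200 * K * ℓ` for the number of samples, whose honest probability is `1 / (2 * M)` per
  -- round.
  set N := ⌈200 * B ^ 2 * K * M ^ 5 / η ^ 4 * ℓ⌉₊ with hN
  have hNle : 200 * B ^ 2 * K * M ^ 5 / η ^ 4 * ℓ ≤ (N : ℝ) := Nat.le_ceil _
  have hK' : (1 : ℝ) ≤ K := by exact_mod_cast hK
  have hKℓ : 1 ≤ K * ℓ := one_le_mul_of_one_le_of_one_le hK' hℓ
  have hNs : 2 * ℓ ≤ N * (s ^ 2 / (4 * (22 * M * B ^ 2))) := by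
    have e : s ^ 2 / (4 * (22 * M * B ^ 2)) = η ^ 4 / (88 * M ^ 5 * B ^ 2) := by
      rw [hs]; field_simp; norm_num
    have h1 : 200 * B ^ 2 * K * M ^ 5 / η ^ 4 * ℓ * (η ^ 4 / (88 * M ^ 5 * B ^ 2)) =
        200 / 88 * (K * ℓ) := by
      field_simp
    rw [e]
    have h2 := mul_le_mul_of_nonneg_right hNle
      (by positivity : 0 ≤ η ^ 4 / (88 * M ^ 5 * B ^ 2))
    rw [h1] at h2
    nlinarith
  have hNM : 200 * (K * ℓ) * M ≤ N := by
    refine le_trans ?_ hNle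
    have h1 : M ≤ B ^ 2 * M ^ 5 / η ^ 4 := by
      rw [le_div_iff₀ (by positivity)]
      have h2 : M ≤ M ^ 5 := le_self_pow₀ hM1 (by norm_num)
      have h3 : (1 : ℝ) ≤ B ^ 2 := one_le_pow₀ hB1
      calc M * η ^ 4 ≤ M * 1 := by gcongr
        _ ≤ 1 * M ^ 5 := by linarith
        _ ≤ B ^ 2 * M ^ 5 := by gcongr
    calc 200 * (K * ℓ) * M ≤ 200 * (K * ℓ) * (B ^ 2 * M ^ 5 / η ^ 4) := by gcongr
      _ = _ := by ring
  have htail := QVerifier.exp_neg_two_log_le hδ hδ1 hNs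
  refine ⟨QVerifier.energyVerifier (fun j => QVerifier.gateAt C j) W (2 * s) N,
    QVerifier.rounds_bound hn hB1 hK hη hη1 hℓ, ?_, ?_, ?_⟩
  · simp only [Fintype.card_sum, Fintype.card_fin, Fintype.card_unit]
    omega
  · intro D hD hDη
    set ψ := QVerifier.alignPhase C (QVerifier.qsample D) with hψdef
    have hψ2 : ∀ x, ‖ψ x‖ ^ 2 = D x := QVerifier.norm_sq_alignPhase_qsample C hD.1
    have hψ : ∑ x, ‖ψ x‖ ^ 2 = 1 := by
      simp only [hψ2]
      exact hD.2
    have hw : ∀ x, QVerifier.advWeight (QVerifier.pureState (QVerifier.historyState C ψ)) x =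
        M⁻¹ * D x := fun x => by rw [QVerifier.advWeight_historyState, hψ2]
    have hq : QVerifier.advProb (QVerifier.pureState (QVerifier.historyState C ψ)) = M⁻¹ := by
      simp only [QVerifier.advProb, hw, ← Finset.mul_sum]
      rw [hD.2, mul_one]
    refine ⟨?_, QVerifier.energyVerifier_samplesIID (fun x => by rw [hw, hq]) _ _⟩
    have hNM' : 200 * (K * ℓ) ≤ N * M⁻¹ := by
      rw [← div_eq_mul_inv, le_div_iff₀ (by positivity)]
      exact hNM
    have hKK : (K : ℝ) ≤ K * ℓ := le_mul_of_one_le_right (by linarith) hℓ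
    have hℓK : ℓ ≤ K * ℓ := le_mul_of_one_le_left (by linarith) hK'
    have hfin := QVerifier.energyVerifier_complete (c := 1 * (K : ℝ)) (ε := δ / 2) (N := N)
      (QVerifier.isDensity_historyState C hψ) hG hGU hW hB hs0 hs1
      (QVerifier.energy_historyState_le C hD hDη) (by rw [hq]; positivity) htail
      (QVerifier.exp_neg_two_log_le hδ hδ1 (by rw [hq]; linarith)) (by rw [hq]; linarith)
    linarith
  · intro ρ hρ hacc
    have hE : QVerifier.energy (fun j => QVerifier.gateAt C j) ρ ≤ 3 * s := by
      by_contra hlt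
      have := (QVerifier.energyVerifier_sound hρ hG hGU hW hB hs0 hs1 (le_of_not_ge hlt) N).trans
        htail
      -- Otherwise acceptance would have probability at most `δ / 2 < 1 / 6`, contradicting `hacc`.
      linarith
    obtain ⟨A, rfl⟩ := QVerifier.exists_eq_mul_conjTranspose hρ.1
    obtain ⟨hq, hd⟩ := QVerifier.low_energy_sound C A hρ hη hη0 hE
    refine ⟨hq, QVerifier.energyVerifier_samplesIID (fun x => ?_) _ _, hd.trans ?_⟩
    · rw [QVerifier.advDist, mul_div_cancel₀ _ hq.ne']
    · have : η ^ (1 : ℝ) ≤ η ^ (1 / 4 : ℝ) :=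
        Real.rpow_le_rpow_of_exponent_ge hη hη1 (by norm_num)
      rw [Real.rpow_one] at this
      linarith
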